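/- For a finite group $G$, let $D(G)$ be its quantum double over $\mathbb{C}$: the Hopf algebra with basis $g\delta_x$ ($g,x\in G$), multiplication $(g\delta_x)(h\delta_y)=gh\,\delta_y$ if $h^{-1}xh=y$ and $0$ otherwise, unit $\sum_{x\in G}\delta_x$, comultiplication $\Delta(g\delta_x)=\sum_{uv=x}g\delta_u\otimes g\delta_v$, counit $\varepsilon(g\delta_x)=1$ if $x=1$ and $0$ otherwise, and antipode $S(g\delta_x)=g^{-1}\delta_{gx^{-1}g^{-1}}$. Let $\Lambda\in D(G)$ be a left integral, i.e. $a\Lambda=\varepsilon(a)\Lambda$ for all $a\in D(G)$, with $\varepsilon(\Lambda)=1$. For an irreducible representation $V$ of $D(G)$ and $n\ge 0$, the $n$-th Frobenius--Schur indicator is $$\nu_n(V)=\mathrm{Tr}_V(\Lambda_1\cdots\Lambda_n),\qquad \Lambda_1\otimes\cdots\otimes\Lambda_n=\Delta_n(\Lambda)$$ (Sweedler notation), where $\Delta_n:D(G)\to D(G)^{\otimes n}$ is the iterated comultiplication, $\Delta_0=\varepsilon$, $\Delta_{n+1}=(\Delta_n\otimes\mathrm{id})\circ\Delta$. **Theorem.**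 Let $A$ be a finite abelian group, $N\ge 0$, and $G=S_N\ltimes A^N$, where $S_N$ permutes the coordinates of $A^N$. Then for every irreducible representation $V$ of $D(G)$ and every $n\ge 0$, the indicator $\nu_n(V)$ is a rational integer. -/

import Mathlib

open scoped TensorProduct

/-- The wreath product `S_N ⋉ A^N`, where `S_N` permutes the `N` coordinates of `A^N`. -/
abbrev WreathProduct (A : Type*) [CommGroup A] (N : ℕ) : Type _ :=
  (Fin N → A) ⋊[mulAutArrow] Equiv.Perm (Fin N)

noncomputable instance WreathProduct.instFintype (A : Type*) [CommGroup A] [Finite A] (N : ℕ) :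
    Fintype (WreathProduct A N) :=
  haveI : Finite (WreathProduct A N) := Finite.of_equiv _ SemidirectProduct.equivProd.symm
  Fintype.ofFinite _

/-- The quantum double `D(G)` of a finite group `G` over `k`: the vector space with basis
`g δ_x` for `g, x ∈ G`. The Hopf algebra structure is constructed below. -/
def QuantumDouble (k : Type*) (G : Type*) [CommRing k] : Type _ := G × G →₀ k

namespace QuantumDouble

noncomputable section

variable {k : Type*} {G : Type*} [CommRing k]

instance : AddCommGroup (QuantumDouble k G) := inferInstanceAs (AddCommGroup (G × G →₀ k))

instance : Module k (QuantumDouble k G) := inferInstanceAs (Module k (G × G →₀ k))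

/-- The basis vector `g δ_x` of the quantum double. -/
def gδ (k : Type*) {G : Type*} [CommRing k] (g x : G) : QuantumDouble k G :=
  Finsupp.single (g, x) (1 : k)

/-- The linear map with prescribed values on the basis `g δ_x`. -/
def extend {M : Type*} [AddCommGroup M] [Module k M] (f : G → G → M) :
    QuantumDouble k G →ₗ[k] M :=
  Finsupp.lsum k (fun p : G × G => LinearMap.toSpanSingleton k M (f p.1 p.2))

@[simp]
theorem extend_gδ {M : Type*} [AddCommGroup M] [Module k M] (f : G → G → M) (g x : G) :
    extend f (gδ k g x) = f g x := by
  unfold extend gδ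
  erw [Finsupp.lsum_single]
  simp

theorem hom_ext {M : Type*} [AddCommGroup M] [Module k M] {f f' : QuantumDouble k G →ₗ[k] M}
    (h : ∀ g x, f (gδ k g x) = f' (gδ k g x)) : f = f' := by
  refine Finsupp.lhom_ext' fun p => LinearMap.ext_ring ?_
  exact h p.1 p.2

theorem induction_on {p : QuantumDouble k G → Prop} (a : QuantumDouble k G)
    (zero : p 0) (basis : ∀ g x, p (gδ k g x)) (add : ∀ a b, p a → p b → p (a + b))
    (smul : ∀ (r : k) a, p a → p (r • a)) : p a := by
  refine Finsupp.induction_linear (motive := p) a ?_ add ?_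
  · exact zero
  · intro q r
    have := smul r _ (basis q.1 q.2)
    unfold gδ at this
    erw [Finsupp.smul_single, smul_eq_mul, mul_one] at this
    exact this

variable [Group G]

open Classical in
/-- The multiplication of `D(G)`, determined by `δ_x h = h δ_{h⁻¹ x h}` and
`δ_x δ_y = δ_{x,y} δ_y`: one has `(g δ_x) (h δ_y) = gh δ_y` if `h⁻¹ x h = y`, and `0` otherwise. -/
def mulHom : QuantumDouble k G →ₗ[k] QuantumDouble k G →ₗ[k] QuantumDouble k G :=
  extend fun g x => extend fun h y => if h⁻¹ * x * h = y then gδ k (g * h) y else 0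

instance : Mul (QuantumDouble k G) := ⟨fun a b => mulHom a b⟩

theorem mul_def (a b : QuantumDouble k G) : a * b = mulHom a b := rfl

open Classical in
theorem gδ_mul_gδ (g x h y : G) :
    gδ k g x * gδ k h y = if h⁻¹ * x * h = y then gδ k (g * h) y else 0 := by
  simp [mul_def, mulHom]

theorem mul_assoc' (a b c : QuantumDouble k G) : a * b * c = a * (b * c) := by
  simp only [mul_def]
  induction a using induction_on with
  | zero => simp
  | add a a' h h' => simp only [map_add, LinearMap.add_apply, h, h']
  | smul r a h => simp only [map_smul, LinearMap.smul_apply, h]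
  | basis g x =>
  induction b using induction_on with
  | zero => simp
  | add a a' h h' => simp only [map_add, LinearMap.add_apply, h, h']
  | smul r a h => simp only [map_smul, LinearMap.smul_apply, h]
  | basis h y =>
  induction c using induction_on with
  | zero => simp
  | add a a' h h' => simp only [map_add, h, h']
  | smul r a h => simp only [map_smul, h]
  | basis l z =>
  classical
  simp only [← mul_def, gδ_mul_gδ]
  by_cases h₁ : h⁻¹ * x * h = y <;> by_cases h₂ : l⁻¹ * y * l = z
  · subst h₁ h₂
    simp [gδ_mul_gδ, mul_assoc]
  · rw [if_pos h₁, if_neg h₂, gδ_mul_gδ, if_neg h₂]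
    simp [mul_def]
  · rw [if_neg h₁, if_pos h₂, gδ_mul_gδ, if_neg]
    · simp [mul_def]
    · intro h₃
      apply h₁
      rw [← h₂] at h₃
      have h₄ := congrArg (fun t => l * t * l⁻¹) h₃
      simpa [mul_assoc] using h₄
  · rw [if_neg h₁, if_neg h₂]
    simp [mul_def]

variable [Fintype G]

/-- The unit of `D(G)` is `∑ₓ δ_x`. -/
instance : One (QuantumDouble k G) := ⟨∑ x : G, gδ k 1 x⟩

theorem one_def : (1 : QuantumDouble k G) = ∑ x : G, gδ k 1 x := rfl

theorem one_mul' (a : QuantumDouble k G) : 1 * a = a := by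
  have : mulHom (1 : QuantumDouble k G) = LinearMap.id := by
    classical
    refine hom_ext fun g x => ?_
    have h : ∀ y : G, (g⁻¹ * y * g = x) ↔ y = g * x * g⁻¹ := fun y => by
      constructor
      · rintro rfl; group
      · rintro rfl; group
    simp [one_def, mulHom, h]
  exact LinearMap.congr_fun this a

theorem mul_one' (a : QuantumDouble k G) : a * 1 = a := by
  have : mulHom.flip (1 : QuantumDouble k G) = LinearMap.id := by
    classical
    refine hom_ext fun g x => ?_
    simp [one_def, mulHom]
  exact LinearMap.congr_fun this a

instance : Ring (QuantumDouble k G) :=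
  { (inferInstance : AddCommGroup (QuantumDouble k G)) with
    mul := (· * ·)
    one := 1
    left_distrib := fun a b c => by simp [mul_def]
    right_distrib := fun a b c => by simp [mul_def]
    zero_mul := fun a => by simp [mul_def]
    mul_zero := fun a => by simp [mul_def]
    mul_assoc := mul_assoc'
    one_mul := one_mul'
    mul_one := mul_one' }

instance : Algebra k (QuantumDouble k G) :=
  Algebra.ofModule (fun r a b => by simp [mul_def]) (fun r a b => by simp [mul_def])

open Classical in
/-- The coalgebra structure of `D(G)`, determined by `Δ(g) = g ⊗ g` and
`Δ(δ_x) = ∑_{uv = x} δ_u ⊗ δ_v`, `ε(g) = 1` and `ε(δ_x) = δ_{x,1}`. -/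
instance : CoalgebraStruct k (QuantumDouble k G) where
  comul := extend fun g x => ∑ u : G, gδ k g u ⊗ₜ[k] gδ k g (u⁻¹ * x)
  counit := extend fun _ x => if x = 1 then 1 else 0

theorem comul_gδ (g x : G) : Coalgebra.comul (R := k) (gδ k g x) =
    ∑ u : G, gδ k g u ⊗ₜ[k] gδ k g (u⁻¹ * x) :=
  extend_gδ _ _ _

open Classical in
theorem counit_gδ (g x : G) : Coalgebra.counit (R := k) (gδ k g x) =
    if x = 1 then (1 : k) else 0 :=
  extend_gδ _ _ _

instance : Coalgebra k (QuantumDouble k G) where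
  coassoc := hom_ext fun g x => by
    simp only [LinearMap.comp_apply, comul_gδ, map_sum, LinearMap.rTensor_tmul,
      LinearMap.lTensor_tmul, TensorProduct.sum_tmul, TensorProduct.tmul_sum,
      LinearEquiv.coe_coe, TensorProduct.assoc_tmul]
    rw [Finset.sum_comm]
    refine Finset.sum_congr rfl fun u _ => ?_
    refine Fintype.sum_equiv (Equiv.mulLeft u⁻¹) _ _ fun v => ?_
    simp [mul_assoc]
  rTensor_counit_comp_comul := hom_ext fun g x => by
    classical
    simp only [LinearMap.comp_apply, comul_gδ, map_sum, LinearMap.rTensor_tmul, counit_gδ]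
    rw [Finset.sum_eq_single 1] <;> simp +contextual
  lTensor_counit_comp_comul := hom_ext fun g x => by
    classical
    simp only [LinearMap.comp_apply, comul_gδ, map_sum, LinearMap.lTensor_tmul, counit_gδ]
    rw [Finset.sum_eq_single x]
    · simp
    · intro b _ hb
      rw [if_neg (by simpa [inv_mul_eq_one] using hb)]
      simp
    · simp

theorem counit_mul' (a b : QuantumDouble k G) : Coalgebra.counit (R := k) (a * b) =
    Coalgebra.counit (R := k) a * Coalgebra.counit (R := k) b := by
  induction a using induction_on with
  | zero => simp
  | add a a' h h' => simp only [map_add, add_mul, h, h']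
  | smul r a h => simp only [map_smul, smul_mul_assoc, h]
  | basis g x =>
  induction b using induction_on with
  | zero => simp
  | add a a' h h' => simp only [map_add, mul_add, h, h']
  | smul r a h => simp only [map_smul, mul_smul_comm, h]
  | basis h y =>
  classical
  rw [gδ_mul_gδ, counit_gδ, counit_gδ]
  by_cases hx : x = 1
  · subst hx
    by_cases hy : y = 1
    · simp [hy, counit_gδ]
    · simp [hy, Ne.symm hy]
  · by_cases hy : y = 1
    · subst hy
      have : ¬ h⁻¹ * x * h = 1 := fun e => hx (by
        have := congrArg (fun t => h * t * h⁻¹) e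
        simpa [mul_assoc] using this)
      simp [this, hx]
    · split_ifs <;> simp [counit_gδ, hy]

theorem comul_mul' (a b : QuantumDouble k G) : Coalgebra.comul (R := k) (a * b) =
    Coalgebra.comul (R := k) a * Coalgebra.comul (R := k) b := by
  induction a using induction_on with
  | zero => simp
  | add a a' h h' => simp only [map_add, add_mul, h, h']
  | smul r a h => simp only [map_smul, smul_mul_assoc, h]
  | basis g x =>
  induction b using induction_on with
  | zero => simp
  | add a a' h h' => simp only [map_add, mul_add, h, h']
  | smul r a h => simp only [map_smul, mul_smul_comm, h]
  | basis h y =>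
  classical
  rw [gδ_mul_gδ, comul_gδ, comul_gδ, Finset.sum_mul_sum]
  simp only [Algebra.TensorProduct.tmul_mul_tmul, gδ_mul_gδ]
  have key : ∀ u v : G,
      (if h⁻¹ * u * h = v then gδ k (g * h) v else 0) ⊗ₜ[k]
        (if h⁻¹ * (u⁻¹ * x) * h = v⁻¹ * y then gδ k (g * h) (v⁻¹ * y) else 0) =
      if u = h * v * h⁻¹ then (if h⁻¹ * x * h = y then
        gδ k (g * h) v ⊗ₜ[k] gδ k (g * h) (v⁻¹ * y) else 0) else 0 := by
    intro u v
    by_cases hu : u = h * v * h⁻¹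
    · subst hu
      have e₁ : h⁻¹ * (h * v * h⁻¹) * h = v := by group
      have e₂ : h⁻¹ * ((h * v * h⁻¹)⁻¹ * x) * h = v⁻¹ * (h⁻¹ * x * h) := by group
      rw [e₁, e₂]
      by_cases hy : h⁻¹ * x * h = y <;> simp [hy]
    · have : ¬ h⁻¹ * u * h = v := fun e => hu (by rw [← e]; group)
      simp [hu, this]
  simp only [key]
  rw [Finset.sum_comm]
  simp only [Finset.sum_ite_eq', Finset.mem_univ, if_true]
  by_cases hy : h⁻¹ * x * h = y
  · simp [hy, comul_gδ]
  · simp [hy]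

instance : Bialgebra k (QuantumDouble k G) :=
  Bialgebra.mk' k _
    (by
      classical
      simp [one_def, counit_gδ])
    (counit_mul' _ _)
    (by
      simp only [one_def, map_sum, comul_gδ, Algebra.TensorProduct.one_def,
        TensorProduct.sum_tmul, TensorProduct.tmul_sum]
      rw [Finset.sum_comm]
      conv_rhs => rw [Finset.sum_comm]
      refine Finset.sum_congr rfl fun u _ => ?_
      exact Fintype.sum_equiv (Equiv.mulLeft u⁻¹) _ _ fun v => rfl)
    (comul_mul' _ _)

/-- The antipode of `D(G)`: `S(g δ_x) = δ_{x⁻¹} g⁻¹ = g⁻¹ δ_{g x⁻¹ g⁻¹}`. -/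
instance : HopfAlgebra k (QuantumDouble k G) where
  antipode := extend fun g x => gδ k g⁻¹ (g * x⁻¹ * g⁻¹)
  mul_antipode_rTensor_comul := hom_ext fun g x => by
    classical
    simp only [LinearMap.comp_apply, comul_gδ, map_sum, LinearMap.rTensor_tmul, extend_gδ,
      LinearMap.mul'_apply, gδ_mul_gδ, counit_gδ]
    by_cases hx : x = 1
    · subst hx
      simp [mul_assoc, one_def]
      exact Fintype.sum_equiv (Equiv.inv G) _ _ fun v => rfl
    · have : ∀ u : G, ¬ g⁻¹ * (g * u⁻¹ * g⁻¹) * g = u⁻¹ * x := fun u e => hx (by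
        simpa [mul_assoc] using e)
      simp [hx, this]
  mul_antipode_lTensor_comul := hom_ext fun g x => by
    classical
    simp only [LinearMap.comp_apply, comul_gδ, map_sum, LinearMap.lTensor_tmul, extend_gδ,
      LinearMap.mul'_apply, gδ_mul_gδ, counit_gδ]
    by_cases hx : x = 1
    · subst hx
      simp [mul_assoc, one_def]
      exact Fintype.sum_equiv (MulAut.conj g).toEquiv _ _ fun v => by simp [mul_assoc]
    · have : ∀ u : G, ¬ g⁻¹⁻¹ * u * g⁻¹ = g * (u⁻¹ * x)⁻¹ * g⁻¹ := fun u e => hx (by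
        simpa [mul_assoc] using e)
      simp only [if_neg (this _), hx]
      simp

end

end QuantumDouble

section Indicators

variable (k : Type*) [CommRing k] {H : Type*} [Ring H] [HopfAlgebra k H]

/-- `Λ ∈ H` is a left integral if `h Λ = ε(h) Λ` for all `h ∈ H`. -/
def IsLeftIntegral (Λ : H) : Prop :=
  ∀ h : H, h * Λ = Coalgebra.counit (R := k) h • Λ

/-- The iterated comultiplication `Δ_n : H → H^{⊗n}`, with `Δ_0 = ε` and
`Δ_{n+1} = (Δ_n ⊗ id) ∘ Δ`; in particular `Δ_1 = id` and `Δ_2 = Δ`. -/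
noncomputable def iteratedComul : (n : ℕ) → H →ₗ[k] ⨂[k]^n H
  | 0 => (TensorPower.algebraMap₀ (R := k) (M := H)).toLinearMap ∘ₗ Coalgebra.counit
  | n + 1 => (TensorPower.mulEquiv (R := k) (M := H) (n := n) (m := 1)).toLinearMap ∘ₗ
      TensorProduct.map (iteratedComul n)
        (PiTensorProduct.subsingletonEquiv (R := k) (s := fun _ : Fin 1 => H) 0).symm.toLinearMap
      ∘ₗ Coalgebra.comul

/-- The multiplication `H^{⊗n} → H`, `h_1 ⊗ ⋯ ⊗ h_n ↦ h_1 ⋯ h_n`. -/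
noncomputable def iteratedMul (n : ℕ) : ⨂[k]^n H →ₗ[k] H :=
  PiTensorProduct.lift (MultilinearMap.mkPiAlgebraFin k n H)

/-- The Frobenius-Schur indicator `ν_n(V) = Tr_V(Λ_1 ⋯ Λ_n)` of an `H`-module `V`, where
`Λ_1 ⊗ ⋯ ⊗ Λ_n = Δ_n(Λ)`; here `Λ` is meant to be a left integral with `ε(Λ) = 1`. -/
noncomputable def frobeniusSchurIndicator (Λ : H) (V : Type*) [AddCommGroup V] [Module k V]
    [Module H V] [IsScalarTower k H V] (n : ℕ) : k :=
  LinearMap.trace k V (Algebra.lsmul k k V (iteratedMul k n (iteratedComul k n Λ)))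

end Indicators

/-- The normalized left integral of `D(G)` is `|G|⁻¹ (∑_g g) δ_1`. -/
theorem QuantumDouble.exists_isLeftIntegral (G : Type*) [Group G] [Fintype G] :
    ∃ Λ : QuantumDouble ℂ G, IsLeftIntegral ℂ Λ ∧ Coalgebra.counit (R := ℂ) Λ = 1 := by
  classical
  refine ⟨(Fintype.card G : ℂ)⁻¹ • ∑ g : G, gδ ℂ g 1, fun a => ?_, ?_⟩
  · rw [mul_smul_comm, smul_comm]
    congr 1
    induction a using induction_on with
    | zero => simp
    | add a a' h h' => simp only [map_add, add_mul, add_smul, h, h']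
    | smul r a h => simp only [map_smul, smul_mul_assoc, smul_assoc, h]
    | basis g x =>
    rw [Finset.mul_sum, counit_gδ]
    simp only [gδ_mul_gδ]
    by_cases hx : x = 1
    · subst hx
      simp only [mul_one, inv_mul_cancel, if_true, one_smul]
      exact Fintype.sum_equiv (Equiv.mulLeft g) _ _ fun v => rfl
    · have : ∀ h : G, ¬ h⁻¹ * x * h = 1 := fun h e => hx (by
        have := congrArg (fun t => h * t * h⁻¹) e
        simpa [mul_assoc] using this)
      simp [hx, this]
  · simp [counit_gδ]

/-! The indicator is shown to be an algebraic integer and a rational number.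

Integrality holds for every finite group. On `V^{⊗n}` the element `Δ_n(Λ)` acts by an idempotent `P`
commuting with the cyclic shift `C`, and `ν_n(V)` is the trace of `P * C`
(`isIntegral_trace_sweedlerPower`). Its eigenvalues are zero or roots of unity.

For rationality, `ν_n(V)` is `|G|⁻¹` times the sum over `y, z` of `#{a | a^n = z = (a y)^n}` times
the trace of `z⁻¹ δ_y` (`frobeniusSchurIndicator_eq_sum`). If these counts are unchanged under `z ↦
z^j` for `j` prime to `|G|`, the traces can be averaged over such `j`, and the averages are rational
(`sum_coprime_trace_mem_rat`).

The invariance of the counts is where the wreath product enters: it is the centralizer of the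
translations by `A` on `X = Fin N × A`. Let `Γ` be the abelian group generated by `z` and these
translations. Two roots `a` and `b = a y` of `z` are `Γ`-equivariant, and one seeks a
`Γ`-equivariant `κ`, preserving each `Γ`-orbit, such that `κ a` and `κ b` are both roots of `z^j`
(`exists_twist`). On an orbit of `⟨a, b⟩` in `X/Γ` the `Γ`-stabilizer `S` is constant. Each cycle of
length `d` there makes `z` an `n/d`-th power in `Γ/S`, so `z = w^L` with `L` the lcm of all these
`n/d`. Let `κ` act by `w^e` for an integer function `e` on the orbits. The problem becomes additive:
the sums of `e` over `n` iterates of `a` and of `b` must both be `(j - 1) L`. Each condition alone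
is solvable, and both solutions have the same total, so their difference is a sum of coboundaries
for `a` and `b` that can be absorbed (`exists_iterateSum_eq_iterateSum_eq`). -/

/-! ### Integer functions with prescribed sums along the cycles of two permutations -/

section OrbitSums

variable {Y : Type*}

/-- The sum of `e` over the points `α p, α² p, …, αⁿ p`. -/
def iterateSum (α : Equiv.Perm Y) (n : ℕ) (e : Y → ℤ) (p : Y) : ℤ :=
  ∑ i ∈ Finset.range n, e ((α ^ (i + 1)) p)

theorem iterateSum_apply {α : Equiv.Perm Y} {n : ℕ} (hα : α ^ n = 1) (e : Y → ℤ) (p : Y) :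
    iterateSum α n e (α p) = iterateSum α n e p := by
  unfold iterateSum
  have h : ∀ i, (α ^ (i + 1)) (α p) = (α ^ (i + 1 + 1)) p := fun i => by
    rw [pow_succ α (i + 1), Equiv.Perm.mul_apply]
  simp only [h]
  have h₁ := Finset.sum_range_succ' (fun i => e ((α ^ (i + 1)) p)) n
  have h₂ := Finset.sum_range_succ (fun i => e ((α ^ (i + 1)) p)) n
  have h₃ : (α ^ (n + 1)) p = (α ^ (0 + 1)) p := by rw [pow_succ, hα]; simp
  rw [h₃] at h₂
  linarith

theorem iterateSum_pow_apply {α : Equiv.Perm Y} {n : ℕ} (hα : α ^ n = 1) (e : Y → ℤ) (p : Y)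
    (i : ℕ) : iterateSum α n e ((α ^ i) p) = iterateSum α n e p := by
  induction i with
  | zero => simp
  | succ i ih => rw [pow_succ', Equiv.Perm.mul_apply, iterateSum_apply hα, ih]

/-- Coboundaries cancel over `n` iterates because `α ^ n = 1`. This is the freedom used to reconcile
the solutions for two permutations. -/
theorem iterateSum_add_sub_comp {α : Equiv.Perm Y} {n : ℕ} (hα : α ^ n = 1) (e g : Y → ℤ) (p : Y) :
    iterateSum α n (fun q => e q + (g q - g (α q))) p = iterateSum α n e p := by
  have h := iterateSum_apply hα g p
  unfold iterateSum at h ⊢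
  simp only [Finset.sum_add_distrib, Finset.sum_sub_distrib]
  have h' : ∀ i, α ((α ^ (i + 1)) p) = (α ^ (i + 1)) (α p) := fun i => by
    rw [← Equiv.Perm.mul_apply, ← Equiv.Perm.mul_apply, ← pow_succ, ← pow_succ']
  simp only [h', h]
  ring

theorem sum_iterateSum [Fintype Y] (α : Equiv.Perm Y) (n : ℕ) (e : Y → ℤ) :
    ∑ p, iterateSum α n e p = n * ∑ p, e p := by
  unfold iterateSum
  rw [Finset.sum_comm]
  simp only [Equiv.sum_comp]
  simp

theorem card_pow_apply_eq_self (α : Equiv.Perm Y) (n : ℕ) (p : Y)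
    [DecidablePred fun i : ℕ => (α ^ (i + 1)) p = p] :
    (Finset.filter (fun i => (α ^ (i + 1)) p = p) (Finset.range n)).card =
      n / MulAction.period α p := by
  rw [← Nat.card_multiples]
  congr 1
  ext i
  simp only [Finset.mem_filter, Finset.mem_range, and_congr_right_iff]
  intro _
  exact MulAction.pow_smul_eq_iff_period_dvd (n := i + 1) (m := α) (a := p)

/-- On an invariant set on which `n / period` divides `L`, the constant function `L` is a sum
over iterates, of a function that vanishes outside of the set. -/
theorem exists_iterateSum_eq [Finite Y] {α : Equiv.Perm Y} {n : ℕ} (hα : α ^ n = 1)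
    (o : Set Y) (ho : ∀ p, α p ∈ o ↔ p ∈ o) (L : ℤ)
    (hL : ∀ p ∈ o, ((n / MulAction.period α p : ℕ) : ℤ) ∣ L) :
    ∃ e : Y → ℤ, (∀ p ∉ o, e p = 0) ∧ ∀ p ∈ o, iterateSum α n e p = L := by
  classical
  let S := Equiv.Perm.SameCycle.setoid α
  let r : Y → Y := fun p => (Quotient.mk S p).out
  have hr : ∀ p, α.SameCycle (r p) p := fun p => Quotient.exact (Quotient.out_eq (Quotient.mk S p))
  have hrr : ∀ p q, α.SameCycle p q → r p = r q := fun p q h => by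
    simp only [r]
    rw [Quotient.sound (s := S) h]
  have hoi : ∀ (i : ℕ) p, (α ^ i) p ∈ o ↔ p ∈ o := by
    intro i
    induction i with
    | zero => simp
    | succ i ih => intro p; rw [pow_succ', Equiv.Perm.mul_apply, ho, ih]
  -- All the weight sits on one representative per cycle, which `n` iterates visit `n / period`
  -- times.
  refine ⟨fun p => if p ∈ o ∧ r p = p then L / ((n / MulAction.period α p : ℕ) : ℤ) else 0,
    fun p hp => by simp [hp], fun p hp => ?_⟩
  obtain ⟨i, hi⟩ := (hr p).symm.exists_nat_pow_eq
  rw [← iterateSum_pow_apply hα _ p i, hi]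
  have hro : r p ∈ o := by rw [← hi, hoi]; exact hp
  unfold iterateSum
  have : ∀ j, (if (α ^ (j + 1)) (r p) ∈ o ∧ r ((α ^ (j + 1)) (r p)) = (α ^ (j + 1)) (r p) then
      L / ((n / MulAction.period α ((α ^ (j + 1)) (r p)) : ℕ) : ℤ) else 0) =
      if (α ^ (j + 1)) (r p) = r p then L / ((n / MulAction.period α (r p) : ℕ) : ℤ) else 0 := by
    intro j
    have h₁ : r ((α ^ (j + 1)) (r p)) = r p := by
      apply hrr
      exact ((hr p).symm.trans ⟨(j + 1 : ℕ), by rw [zpow_natCast]⟩).symm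
    rw [h₁]
    by_cases h : (α ^ (j + 1)) (r p) = r p
    · simp only [h, hro, and_self, if_true]
    · rw [if_neg h, if_neg]
      rintro ⟨-, h'⟩
      exact h h'.symm
  simp only [this]
  rw [← Finset.sum_filter, Finset.sum_const, card_pow_apply_eq_self, nsmul_eq_mul]
  exact Int.mul_ediv_cancel' (hL _ hro)

/-- An integer function with total sum zero that is supported on an orbit of the group generated
by `α` and `β` vanishes in the coinvariants of that group. -/
theorem exists_eq_sub_comp_add_sub_comp [Fintype Y] (α β : Equiv.Perm Y) (y : Y) (h : Y → ℤ)
    (hsupp : ∀ p ∉ MulAction.orbit (Subgroup.closure {α, β}) y, h p = 0) (hsum : ∑ p, h p = 0) :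
    ∃ g g' : Y → ℤ, ∀ p, h p = (g p - g (α p)) + (g' p - g' (β p)) := by
  classical
  let φ : (Y → ℤ) × (Y → ℤ) →+ (Y → ℤ) :=
    { toFun := fun g p => (g.1 p - g.1 (α p)) + (g.2 p - g.2 (β p))
      map_zero' := by ext; simp
      map_add' := fun _ _ => by ext; simp; ring }
  suffices hmem : h ∈ φ.range by
    obtain ⟨⟨g, g'⟩, hg⟩ := hmem
    exact ⟨g, g', fun p => (congrFun hg p).symm⟩
  have hgen : ∀ γ ∈ Subgroup.closure ({α, β} : Set (Equiv.Perm Y)), ∀ q,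
      (Pi.single (γ q) 1 - Pi.single q 1 : Y → ℤ) ∈ φ.range := by
    intro γ hγ
    induction hγ using Subgroup.closure_induction with
    | mem γ hγ =>
      intro q
      rcases hγ with rfl | rfl
      · refine ⟨(Pi.single (γ q) 1, 0), ?_⟩
        ext p
        simp [φ, Pi.single_apply]
      · refine ⟨(0, Pi.single (γ q) 1), ?_⟩
        ext p
        simp [φ, Pi.single_apply]
    | one => intro q; simp
    | mul γ γ' _ _ h₁ h₂ =>
      intro q
      have := add_mem (h₁ (γ' q)) (h₂ q)
      simpa using this
    | inv γ _ h₁ =>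
      intro q
      have := neg_mem (h₁ (γ⁻¹ q))
      simpa using this
  -- Total sum zero allows subtracting the point mass at `y` from each point mass without changing
  -- `h`.
  have hh : h = ∑ q, h q • (Pi.single q 1 - Pi.single y 1 : Y → ℤ) := by
    simp only [smul_sub, Finset.sum_sub_distrib, ← Finset.sum_smul, hsum, zero_smul, sub_zero]
    ext p
    simp [Finset.sum_apply, Pi.single_apply]
  rw [hh]
  refine sum_mem fun q _ => ?_
  by_cases hq : q ∈ MulAction.orbit (Subgroup.closure {α, β}) y
  · obtain ⟨⟨γ, hγ⟩, rfl⟩ := hq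
    exact zsmul_mem (hgen γ hγ y) _
  · rw [hsupp q hq, zero_smul]
    exact zero_mem _

/-- If `L` is a multiple of `n / period` for both `α` and `β` at every point of an orbit of the
group generated by `α` and `β`, then the constant function `L` on that orbit is the sum over
iterates of one and the same integer function for `α` and for `β`. -/
theorem exists_iterateSum_eq_iterateSum_eq [Finite Y] {α β : Equiv.Perm Y} {n : ℕ}
    (hα : α ^ n = 1) (hβ : β ^ n = 1) (hn : 0 < n) (y : Y) (L : ℤ)
    (hLα : ∀ p ∈ MulAction.orbit (Subgroup.closure {α, β}) y,
      ((n / MulAction.period α p : ℕ) : ℤ) ∣ L)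
    (hLβ : ∀ p ∈ MulAction.orbit (Subgroup.closure {α, β}) y,
      ((n / MulAction.period β p : ℕ) : ℤ) ∣ L) :
    ∃ e : Y → ℤ, ∀ p ∈ MulAction.orbit (Subgroup.closure {α, β}) y,
      iterateSum α n e p = L ∧ iterateSum β n e p = L := by
  classical
  have := Fintype.ofFinite Y
  set o := MulAction.orbit (Subgroup.closure {α, β}) y with ho
  have hinv : ∀ γ ∈ ({α, β} : Set (Equiv.Perm Y)), ∀ p, γ p ∈ o ↔ p ∈ o := fun γ hγ p => by
    rw [ho, ← MulAction.orbit_eq_iff, ← MulAction.orbit_eq_iff,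
      ← MulAction.orbit_smul (⟨γ, Subgroup.subset_closure hγ⟩ : Subgroup.closure {α, β}) p]
    rfl
  have hα' := hinv α (by simp)
  have hβ' := hinv β (by simp)
  obtain ⟨ea, hea₀, hea⟩ := exists_iterateSum_eq hα o hα' L hLα
  obtain ⟨eb, heb₀, heb⟩ := exists_iterateSum_eq hβ o hβ' L hLβ
  have hout : ∀ (γ : Equiv.Perm Y), (∀ p, γ p ∈ o ↔ p ∈ o) → ∀ e : Y → ℤ, (∀ p ∉ o, e p = 0) →
      (∀ p ∈ o, iterateSum γ n e p = L) →
      ∀ p, iterateSum γ n e p = if p ∈ o then L else 0 := by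
    intro γ hγ e he hL p
    by_cases hp : p ∈ o
    · rw [if_pos hp, hL p hp]
    · rw [if_neg hp]
      refine Finset.sum_eq_zero fun i _ => he _ ?_
      have : ∀ i : ℕ, (γ ^ i) p ∉ o := by
        intro i
        induction i with
        | zero => simpa
        | succ i ih => rwa [pow_succ', Equiv.Perm.mul_apply, hγ]
      exact this _
  -- Summing the iterate sums over all points gives `n` times the total, and both equal `L` times
  -- the size of `o`.
  have hsum : ∑ p, ea p = ∑ p, eb p := by
    have h₁ := sum_iterateSum α n ea
    have h₂ := sum_iterateSum β n eb
    simp only [hout α hα' ea hea₀ hea, hout β hβ' eb heb₀ heb] at h₁ h₂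
    have hn' : (n : ℤ) ≠ 0 := by exact_mod_cast hn.ne'
    exact mul_left_cancel₀ hn' (h₁.symm.trans h₂)
  obtain ⟨g, g', hg⟩ := exists_eq_sub_comp_add_sub_comp α β y (fun p => eb p - ea p)
    (fun p hp => by simp [hea₀ p hp, heb₀ p hp]) (by simp [Finset.sum_sub_distrib, hsum])
  -- Since `eb - ea` is an `α`-coboundary plus a `β`-coboundary, this function differs from `ea` by
  -- the former and from `eb` by the latter.
  refine ⟨fun q => ea q + (g q - g (α q)), fun p hp => ⟨?_, ?_⟩⟩
  · rw [iterateSum_add_sub_comp hα, hea p hp]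
  · have : (fun q => ea q + (g q - g (α q))) =
        fun q => eb q + ((fun t => -g' t) q - (fun t => -g' t) (β q)) := by
      ext q
      have := hg q
      simp only at this ⊢
      linarith
    rw [this, iterateSum_add_sub_comp hβ, heb p hp]

end OrbitSums

/-! ### Roots of lcm order in an abelian group -/

section Divisibility

variable {B : Type*} [CommGroup B]

theorem prod_zpow_eq_zpow_sum {ι : Type*} (s : Finset ι) (w : B) (e : ι → ℤ) :
    ∏ i ∈ s, w ^ e i = w ^ ∑ i ∈ s, e i := by
  classical
  induction s using Finset.induction_on with
  | empty => simp
  | insert i s hi ih => rw [Finset.prod_insert hi, Finset.sum_insert hi, ih, zpow_add]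

/-- Write `m = k g`, `m' = k' g` with `k, k'` coprime. Bézout coefficients of `k, k'` combine the
two roots, since the lcm is `k k' g`. -/
theorem exists_pow_lcm_eq {z w w' : B} {m m' : ℕ} (h : w ^ m = z) (h' : w' ^ m' = z) :
    ∃ W : B, W ^ Nat.lcm m m' = z := by
  obtain ⟨k, k', hk, hm, hm'⟩ := Nat.exists_coprime m m'
  set g := Nat.gcd m m' with hg
  rcases Nat.eq_zero_or_pos g with hg0 | hg0
  · rw [hg0, mul_zero] at hm
    exact ⟨1, by simpa [hm] using h⟩
  have hl : Nat.lcm m m' = k * k' * g := by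
    rw [Nat.lcm, ← hg]
    apply Nat.div_eq_of_eq_mul_left hg0
    conv_lhs => rw [hm, hm']
    ring
  have hb : (k : ℤ) * Nat.gcdA k k' + k' * Nat.gcdB k k' = 1 := by
    rw [← Nat.gcd_eq_gcd_ab, hk]; rfl
  refine ⟨w' ^ Nat.gcdA k k' * w ^ Nat.gcdB k k', ?_⟩
  have e₁ : (w' ^ Nat.gcdA k k') ^ (k * k' * g) = z ^ ((k : ℤ) * Nat.gcdA k k') := by
    rw [← h', ← zpow_natCast, ← zpow_mul, ← zpow_natCast, ← zpow_mul]
    congr 1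
    rw [show (m' : ℤ) = k' * g by exact_mod_cast hm']
    push_cast
    ring
  have e₂ : (w ^ Nat.gcdB k k') ^ (k * k' * g) = z ^ ((k' : ℤ) * Nat.gcdB k k') := by
    rw [← h, ← zpow_natCast, ← zpow_mul, ← zpow_natCast, ← zpow_mul]
    congr 1
    rw [show (m : ℤ) = k * g by exact_mod_cast hm]
    push_cast
    ring
  rw [hl, mul_pow, e₁, e₂, ← zpow_add, hb, zpow_one]

theorem exists_pow_finset_lcm_eq {ι : Type*} (s : Finset ι) (m : ι → ℕ) (z : B)
    (h : ∀ i ∈ s, ∃ w : B, w ^ m i = z) : ∃ W : B, W ^ s.lcm m = z := by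
  classical
  induction s using Finset.induction_on with
  | empty => exact ⟨z, by simp⟩
  | insert i s _ ih =>
    obtain ⟨w, hw⟩ := h i (Finset.mem_insert_self i s)
    obtain ⟨w', hw'⟩ := ih fun j hj => h j (Finset.mem_insert_of_mem hj)
    rw [Finset.lcm_insert]
    exact exists_pow_lcm_eq hw hw'

end Divisibility

/-! ### Simultaneous twisting of two equivariant permutations -/

section Twist

variable {Γ X : Type*} [CommGroup Γ] [MulAction Γ X]

/-- The permutation of the orbits of `Γ` induced by a `Γ`-equivariant permutation. -/
def orbitPerm (a : Equiv.Perm X) (ha : ∀ (c : Γ) x, a (c • x) = c • a x) :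
    Equiv.Perm (MulAction.orbitRel.Quotient Γ X) :=
  Quotient.congr a fun x x' => by
    change x ∈ MulAction.orbit Γ x' ↔ a x ∈ MulAction.orbit Γ (a x')
    simp only [MulAction.mem_orbit_iff]
    refine exists_congr fun c => ?_
    rw [← ha, a.injective.eq_iff]

variable (Γ) in
/-- The orbit of a point, as a point of the orbit space. -/
def orbitClass (x : X) : MulAction.orbitRel.Quotient Γ X := Quotient.mk'' x

theorem orbitClass_eq_iff {x x' : X} : orbitClass Γ x = orbitClass Γ x' ↔ ∃ c : Γ, c • x' = x := by
  unfold orbitClass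
  rw [Quotient.eq'']
  exact MulAction.mem_orbit_iff

@[simp]
theorem orbitClass_smul (c : Γ) (x : X) : orbitClass Γ (c • x) = orbitClass Γ x :=
  orbitClass_eq_iff.2 ⟨c, rfl⟩

theorem orbitClass_surjective : Function.Surjective (orbitClass Γ (X := X)) :=
  Quotient.mk''_surjective

theorem orbitPerm_orbitClass (a : Equiv.Perm X) (ha : ∀ (c : Γ) x, a (c • x) = c • a x) (x : X) :
    orbitPerm a ha (orbitClass Γ x) = orbitClass Γ (a x) := rfl

theorem orbitPerm_pow_orbitClass (a : Equiv.Perm X) (ha : ∀ (c : Γ) x, a (c • x) = c • a x)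
    (i : ℕ) (x : X) : (orbitPerm a ha ^ i) (orbitClass Γ x) = orbitClass Γ ((a ^ i) x) := by
  induction i with
  | zero => simp
  | succ i ih =>
    rw [pow_succ', Equiv.Perm.mul_apply, ih, orbitPerm_orbitClass, pow_succ', Equiv.Perm.mul_apply]

theorem pow_apply_smul {a : Equiv.Perm X} (ha : ∀ (c : Γ) x, a (c • x) = c • a x)
    (i : ℕ) (c : Γ) (x : X) : (a ^ i) (c • x) = c • (a ^ i) x := by
  induction i with
  | zero => simp
  | succ i ih => rw [pow_succ', Equiv.Perm.mul_apply, ih, ha, Equiv.Perm.mul_apply]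

theorem orbitPerm_pow_eq_one {a : Equiv.Perm X} (ha : ∀ (c : Γ) x, a (c • x) = c • a x) {n : ℕ}
    {z : Γ} (han : ∀ x, (a ^ n) x = z • x) : orbitPerm a ha ^ n = 1 := by
  ext y
  obtain ⟨x, rfl⟩ := orbitClass_surjective y
  rw [orbitPerm_pow_orbitClass, han, orbitClass_smul, Equiv.Perm.one_apply]

/-- After `d` steps, `d` the period of the orbit, `a` returns to the orbit of `x` and acts there as
some `s`. Repeating this `n / d` times gives `a ^ n`, that is `z`. -/
theorem exists_pow_div_period_smul_eq {a : Equiv.Perm X} (ha : ∀ (c : Γ) x, a (c • x) = c • a x)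
    {n : ℕ} {z : Γ} (han : ∀ x, (a ^ n) x = z • x) (x : X) :
    ∃ s : Γ, s ^ (n / MulAction.period (orbitPerm a ha) (orbitClass Γ x)) • x = z • x := by
  set d := MulAction.period (orbitPerm a ha) (orbitClass Γ x) with hd
  have hdn : d ∣ n := by
    rw [hd, ← MulAction.pow_smul_eq_iff_period_dvd, orbitPerm_pow_eq_one ha han, one_smul]
  have h₁ : orbitClass Γ ((a ^ d) x) = orbitClass Γ x := by
    rw [← orbitPerm_pow_orbitClass a ha]
    exact MulAction.pow_period_smul (orbitPerm a ha) (orbitClass Γ x)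
  obtain ⟨s, hs⟩ := orbitClass_eq_iff.1 h₁
  refine ⟨s, ?_⟩
  have h₂ : ∀ k : ℕ, (a ^ (d * k)) x = s ^ k • x := by
    intro k
    induction k with
    | zero => simp
    | succ k ih =>
      rw [mul_add, mul_one, add_comm, pow_add, Equiv.Perm.mul_apply, ih, pow_apply_smul ha, ← hs,
        smul_smul, pow_succ]
  rw [← h₂, Nat.mul_div_cancel' hdn, han]

/-- The stabilizers of `Γ` are constant along the orbits of a group of permutations of the orbit
space that lift to equivariant permutations. -/
theorem smul_eq_self_iff_of_mem_closure {s : Set (Equiv.Perm (MulAction.orbitRel.Quotient Γ X))}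
    (hs : ∀ γ ∈ s, ∃ (a : Equiv.Perm X) (ha : ∀ (c : Γ) x, a (c • x) = c • a x),
      orbitPerm a ha = γ)
    {γ : Equiv.Perm (MulAction.orbitRel.Quotient Γ X)} (hγ : γ ∈ Subgroup.closure s) (c : Γ) :
    ∀ x x' : X, orbitClass Γ x' = γ (orbitClass Γ x) → (c • x' = x' ↔ c • x = x) := by
  have hsame : ∀ x x' : X, orbitClass Γ x' = orbitClass Γ x → (c • x' = x' ↔ c • x = x) := by
    intro x x' h
    obtain ⟨c', rfl⟩ := orbitClass_eq_iff.1 h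
    rw [smul_comm, smul_left_cancel_iff]
  induction hγ using Subgroup.closure_induction with
  | mem γ hγ =>
    obtain ⟨a, ha, rfl⟩ := hs γ hγ
    intro x x' h
    rw [hsame (a x) x' h, ← ha, a.injective.eq_iff]
  | one => exact hsame
  | mul γ γ' _ _ h₁ h₂ =>
    intro x x' h
    obtain ⟨x'', hx''⟩ := orbitClass_surjective (γ' (orbitClass Γ x))
    rw [h₁ x'' x' (by rw [h, hx'']; rfl), h₂ x x'' hx'']
  | inv γ _ h₁ =>
    intro x x' h
    exact (h₁ x' x (by rw [h]; simp)).symm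

/-- All stabilizers over the orbit of `y` coincide, say with `S`. In `Γ ⧸ S` the element `z` has
roots of every order `n / period`, hence a root whose order is their lcm `L`. -/
theorem exists_pow_smul_eq_on_orbit [Finite X] {a b : Equiv.Perm X}
    (ha : ∀ (c : Γ) x, a (c • x) = c • a x) (hb : ∀ (c : Γ) x, b (c • x) = c • b x)
    {n : ℕ} {z : Γ} (han : ∀ x, (a ^ n) x = z • x) (hbn : ∀ x, (b ^ n) x = z • x)
    (y : MulAction.orbitRel.Quotient Γ X) :
    ∃ (w : Γ) (L : ℕ), ∀ x : X,
      orbitClass Γ x ∈ MulAction.orbit (Subgroup.closure {orbitPerm a ha, orbitPerm b hb}) y →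
      w ^ L • x = z • x ∧ n / MulAction.period (orbitPerm a ha) (orbitClass Γ x) ∣ L ∧
        n / MulAction.period (orbitPerm b hb) (orbitClass Γ x) ∣ L := by
  classical
  have := Fintype.ofFinite X
  obtain ⟨x₀, rfl⟩ := orbitClass_surjective y
  set o := MulAction.orbit (Subgroup.closure {orbitPerm a ha, orbitPerm b hb}) (orbitClass Γ x₀)
  have hstab : ∀ x : X, orbitClass Γ x ∈ o → ∀ c : Γ, c • x = x ↔ c • x₀ = x₀ := by
    rintro x ⟨⟨γ, hγ⟩, h⟩ c
    refine smul_eq_self_iff_of_mem_closure ?_ hγ c x₀ x h.symm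
    rintro γ (rfl | rfl)
    · exact ⟨a, ha, rfl⟩
    · exact ⟨b, hb, rfl⟩
  have hstab' : ∀ x : X, orbitClass Γ x ∈ o → ∀ c c' : Γ, c • x = c' • x ↔ c • x₀ = c' • x₀ := by
    intro x hx c c'
    have := hstab x hx (c'⁻¹ * c)
    rwa [mul_smul, mul_smul, inv_smul_eq_iff, inv_smul_eq_iff] at this
  let S := MulAction.stabilizer Γ x₀
  have hS : ∀ c c' : Γ, (c : Γ ⧸ S) = (c' : Γ ⧸ S) ↔ c • x₀ = c' • x₀ := by
    intro c c'
    rw [eq_comm, QuotientGroup.eq, MulAction.mem_stabilizer_iff, mul_smul, inv_smul_eq_iff]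
  -- The Boolean selects `a` or `b`, so that one lcm covers the cycles of both.
  let s : Finset (X × Bool) := Finset.univ.filter fun p => orbitClass Γ p.1 ∈ o
  let m : X × Bool → ℕ := fun p =>
    n / MulAction.period (if p.2 then orbitPerm a ha else orbitPerm b hb) (orbitClass Γ p.1)
  obtain ⟨W, hW⟩ := exists_pow_finset_lcm_eq s m (z : Γ ⧸ S) (by
    rintro ⟨x, t⟩ hx
    have hx' : orbitClass Γ x ∈ o := by simpa [s] using hx
    have : ∃ w : Γ, w ^ m (x, t) • x = z • x := by
      cases t
      · exact exists_pow_div_period_smul_eq hb hbn x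
      · exact exists_pow_div_period_smul_eq ha han x
    obtain ⟨w, hw⟩ := this
    exact ⟨w, by rw [← QuotientGroup.mk_pow, hS, ← hstab' x hx', hw]⟩)
  obtain ⟨w, rfl⟩ := QuotientGroup.mk_surjective W
  refine ⟨w, s.lcm m, fun x hx => ⟨?_, ?_, ?_⟩⟩
  · rw [hstab' x hx, ← hS, QuotientGroup.mk_pow, hW]
  · exact Finset.dvd_lcm (s := s) (f := m) (b := (x, true)) (by simpa [s] using hx)
  · exact Finset.dvd_lcm (s := s) (f := m) (b := (x, false)) (by simpa [s] using hx)

/-- The factors are constant on `Γ`-orbits, so they move past `a` and multiply up along its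
trajectory. -/
theorem mul_pow_apply_of_twist {a κ : Equiv.Perm X} (ha : ∀ (c : Γ) x, a (c • x) = c • a x)
    {k : X → Γ} (hk : ∀ (c : Γ) x, k (c • x) = k x) (hκ : ∀ x, κ x = k x • x) (i : ℕ) (x : X) :
    ((κ * a) ^ i) x = (∏ j ∈ Finset.range i, k ((a ^ (j + 1)) x)) • (a ^ i) x := by
  induction i with
  | zero => simp
  | succ i ih =>
    rw [pow_succ', Equiv.Perm.mul_apply, ih, Equiv.Perm.mul_apply, ha, hκ, hk, smul_smul,
      Finset.prod_range_succ, mul_comm, pow_succ', Equiv.Perm.mul_apply]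

/-- If two equivariant permutations `a` and `b` have the same `n`-th power, given by an element
`z` of the abelian group `Γ`, then both can be multiplied by one and the same equivariant
permutation `κ` preserving the orbits of `Γ`, so that their `n`-th powers become `z * z ^ c`. -/
theorem exists_twist [Finite X] {a b : Equiv.Perm X}
    (ha : ∀ (c : Γ) x, a (c • x) = c • a x) (hb : ∀ (c : Γ) x, b (c • x) = c • b x)
    {n : ℕ} {z : Γ} (han : ∀ x, (a ^ n) x = z • x) (hbn : ∀ x, (b ^ n) x = z • x) (c : ℤ) :
    ∃ κ : Equiv.Perm X, (∀ (d : Γ) x, κ (d • x) = d • κ x) ∧ (∀ x, ∃ d : Γ, κ x = d • x) ∧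
      (∀ x, ((κ * a) ^ n) x = (z * z ^ c) • x) ∧ ∀ x, ((κ * b) ^ n) x = (z * z ^ c) • x := by
  -- For `n = 0` the element `z` acts trivially, and no twist is needed.
  rcases Nat.eq_zero_or_pos n with rfl | hn
  · have hz : ∀ x : X, z • x = x := fun x => by simpa using (han x).symm
    have hz' : ∀ x : X, (z * z ^ c) • x = x := fun x => by
      rw [← MulAction.mem_stabilizer_iff]
      exact mul_mem (hz x) (zpow_mem (hz x) c)
    exact ⟨1, by simp, fun x => ⟨1, by simp⟩, by simp [hz'], by simp [hz']⟩
  set α := orbitPerm a ha with hα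
  set β := orbitPerm b hb with hβ
  have hαn : α ^ n = 1 := orbitPerm_pow_eq_one ha han
  have hβn : β ^ n = 1 := orbitPerm_pow_eq_one hb hbn
  choose w L hwL using exists_pow_smul_eq_on_orbit ha hb han hbn
  have hex : ∀ y, ∃ e : MulAction.orbitRel.Quotient Γ X → ℤ,
      ∀ p ∈ MulAction.orbit (Subgroup.closure {α, β}) y,
        iterateSum α n e p = c * L y ∧ iterateSum β n e p = c * L y := by
    intro y
    refine exists_iterateSum_eq_iterateSum_eq hαn hβn hn y (c * L y) ?_ ?_
    · intro p hp
      obtain ⟨x, rfl⟩ := orbitClass_surjective p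
      exact Dvd.dvd.mul_left (Int.natCast_dvd_natCast.2 (hwL y x hp).2.1) _
    · intro p hp
      obtain ⟨x, rfl⟩ := orbitClass_surjective p
      exact Dvd.dvd.mul_left (Int.natCast_dvd_natCast.2 (hwL y x hp).2.2) _
  choose e he using hex
  -- The data `w`, `L`, `e` depend on a base point; a chosen representative makes them constant
  -- along each orbit of `⟨α, β⟩`.
  let R : MulAction.orbitRel.Quotient Γ X → MulAction.orbitRel.Quotient Γ X := fun p =>
    Quotient.out (Quotient.mk (MulAction.orbitRel (Subgroup.closure {α, β}) _) p)
  have hR : ∀ p, p ∈ MulAction.orbit (Subgroup.closure {α, β}) (R p) := fun p =>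
    MulAction.mem_orbit_symm.1 (Quotient.mk_out (s := MulAction.orbitRel _ _) p)
  have hRinv : ∀ γ ∈ Subgroup.closure {α, β}, ∀ p, R (γ p) = R p := by
    intro γ hγ p
    simp only [R]
    congr 1
    exact Quotient.sound (s := MulAction.orbitRel _ _)
      ⟨(⟨γ, hγ⟩ : Subgroup.closure {α, β}), rfl⟩
  let k : X → Γ := fun x => w (R (orbitClass Γ x)) ^ e (R (orbitClass Γ x)) (orbitClass Γ x)
  have hk : ∀ (d : Γ) x, k (d • x) = k x := fun d x => by simp [k]
  let κ : Equiv.Perm X :=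
    { toFun := fun x => k x • x
      invFun := fun x => (k x)⁻¹ • x
      left_inv := fun x => by simp [hk]
      right_inv := fun x => by
        have : k ((k x)⁻¹ • x) = k x := hk _ _
        simp [this] }
  have hκ : ∀ x, κ x = k x • x := fun x => rfl
  have key : ∀ (a' : Equiv.Perm X) (ha' : ∀ (c : Γ) x, a' (c • x) = c • a' x),
      orbitPerm a' ha' ∈ Subgroup.closure {α, β} → (∀ x, (a' ^ n) x = z • x) →
      (∀ y, ∀ p ∈ MulAction.orbit (Subgroup.closure {α, β}) y,
        iterateSum (orbitPerm a' ha') n (e y) p = c * L y) →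
      ∀ x, ((κ * a') ^ n) x = (z * z ^ c) • x := by
    intro a' ha' hmem hn' hsum x
    set y := R (orbitClass Γ x) with hy
    have hterm : ∀ j, k ((a' ^ (j + 1)) x) =
        w y ^ e y ((orbitPerm a' ha' ^ (j + 1)) (orbitClass Γ x)) := by
      intro j
      simp only [k]
      rw [← orbitPerm_pow_orbitClass a' ha', hRinv _ (pow_mem hmem _)]
    rw [mul_pow_apply_of_twist ha' hk hκ, hn', smul_smul]
    simp only [hterm]
    have hprod : ∏ j ∈ Finset.range n,
        w y ^ e y ((orbitPerm a' ha' ^ (j + 1)) (orbitClass Γ x)) = (w y ^ L y) ^ c := by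
      rw [prod_zpow_eq_zpow_sum]
      change w y ^ iterateSum (orbitPerm a' ha') n (e y) (orbitClass Γ x) = _
      rw [hsum y _ (hR _), mul_comm, zpow_mul, zpow_natCast]
    rw [hprod, mul_comm, mul_smul, mul_smul]
    congr 1
    -- `w ^ L` and `z` agree only modulo the stabilizer of `x`, which suffices for their `c`-th
    -- powers to agree on `x`.
    have hst : z⁻¹ * w y ^ L y ∈ MulAction.stabilizer Γ x := by
      rw [MulAction.mem_stabilizer_iff, mul_smul, inv_smul_eq_iff]
      exact (hwL y x (hR _)).1
    have := zpow_mem hst c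
    rwa [mul_zpow, inv_zpow, MulAction.mem_stabilizer_iff, mul_smul, inv_smul_eq_iff] at this
  refine ⟨κ, fun d x => ?_, fun x => ⟨k x, rfl⟩, ?_, ?_⟩
  · rw [hκ, hκ, hk, smul_comm]
  · exact key a ha (Subgroup.subset_closure (by simp [hα])) han fun y p hp => (he y p hp).1
  · exact key b hb (Subgroup.subset_closure (by simp [hβ])) hbn fun y p hp => (he y p hp).2

end Twist

/-! ### Comparing numbers of common roots -/

section Roots

variable {G : Type*} [Group G]

/-- The elements `a` such that `a` and `a * y` are both `n`-th roots of `z`. -/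
def commonRoots (n : ℕ) (y z : G) : Set G := {a | a ^ n = z ∧ (a * y) ^ n = z}

/-- `ν` is the product of the conjugates `a ^ i * κ * a⁻¹ ^ i` for `i < n`. Conjugation by `κ' * a`
agrees with conjugation by `a` on the abelian group `K`, so `ν` does not depend on `κ'`. -/
theorem exists_mul_mul_pow_eq {K : Subgroup G} (hK : ∀ κ ∈ K, ∀ κ' ∈ K, κ * κ' = κ' * κ)
    {a : G} (ha : ∀ κ ∈ K, a * κ * a⁻¹ ∈ K) {κ : G} (hκ : κ ∈ K) (n : ℕ) :
    ∃ ν ∈ K, ∀ κ' ∈ K, (κ * κ' * a) ^ n = ν * (κ' * a) ^ n := by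
  induction n with
  | zero => exact ⟨1, one_mem _, by simp⟩
  | succ n ih =>
    obtain ⟨ν, hν, h⟩ := ih
    refine ⟨κ * (a * ν * a⁻¹), mul_mem hκ (ha ν hν), fun κ' hκ' => ?_⟩
    rw [pow_succ', h κ' hκ', pow_succ' (κ' * a)]
    calc κ * κ' * a * (ν * (κ' * a) ^ n)
        = κ * (κ' * (a * ν * a⁻¹)) * a * (κ' * a) ^ n := by group
      _ = κ * ((a * ν * a⁻¹) * κ') * a * (κ' * a) ^ n := by rw [hK κ' hκ' _ (ha ν hν)]
      _ = κ * (a * ν * a⁻¹) * (κ' * a * (κ' * a) ^ n) := by simp only [mul_assoc]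

/-- A multiplier found for one root works for every root in the same coset of `K`, because it
changes the `n`-th power by the same factor `ν`. -/
theorem mul_pow_eq_of_mul_inv_mem {K : Subgroup G} (hK : ∀ κ ∈ K, ∀ κ' ∈ K, κ * κ' = κ' * κ)
    {a a' κ z z' : G} (ha : ∀ κ ∈ K, a * κ * a⁻¹ ∈ K) (hκ : κ ∈ K) (haa' : a' * a⁻¹ ∈ K) {n : ℕ}
    (haz : a ^ n = z) (haz' : a' ^ n = z) (h : (κ * a) ^ n = z') : (κ * a') ^ n = z' := by
  obtain ⟨ν, -, hν⟩ := exists_mul_mul_pow_eq hK ha hκ n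
  have h₁ := hν 1 (one_mem _)
  have h₂ := hν _ haa'
  rw [mul_one, one_mul, h, haz] at h₁
  rw [mul_assoc, inv_mul_cancel_right, haz'] at h₂
  rw [h₂, h₁]

/-- If the common roots of `z` normalize an abelian subgroup `K`, and each of them can be turned
into a common root of `z'` by an element of `K`, then `z'` has at least as many common roots. -/
theorem card_commonRoots_le [Finite G] {K : Subgroup G}
    (hK : ∀ κ ∈ K, ∀ κ' ∈ K, κ * κ' = κ' * κ) {n : ℕ} {y z z' : G}
    (hnorm : ∀ a ∈ commonRoots n y z, ∀ κ ∈ K, a * κ * a⁻¹ ∈ K ∧ (a * y) * κ * (a * y)⁻¹ ∈ K)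
    (hex : ∀ a ∈ commonRoots n y z, ∃ κ ∈ K, κ * a ∈ commonRoots n y z') :
    Nat.card (commonRoots n y z) ≤ Nat.card (commonRoots n y z') := by
  let S : Setoid (commonRoots n y z) := (QuotientGroup.rightRel K).comap Subtype.val
  have hS : ∀ a a' : commonRoots n y z, S.r a a' ↔ (a' : G) * (a : G)⁻¹ ∈ K := fun a a' =>
    QuotientGroup.rightRel_apply
  let r : commonRoots n y z → commonRoots n y z := fun a => (Quotient.mk S a).out
  have hr : ∀ a : commonRoots n y z, (a : G) * (r a : G)⁻¹ ∈ K := fun a =>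
    (hS _ _).1 (Quotient.mk_out (s := S) a)
  choose κ hκ hκa using hex
  have hmem : ∀ a : commonRoots n y z,
      κ (r a) (r a).2 * (a : G) ∈ commonRoots n y z' := by
    intro a
    have hra := (r a).2
    have h := hκa (r a) hra
    refine ⟨mul_pow_eq_of_mul_inv_mem hK (fun k hk => (hnorm _ hra k hk).1) (hκ _ _) (hr a)
      hra.1 a.2.1 h.1, ?_⟩
    rw [mul_assoc]
    refine mul_pow_eq_of_mul_inv_mem hK (a := (r a : G) * y)
      (fun k hk => (hnorm _ hra k hk).2) (hκ _ _) ?_ hra.2 a.2.2 ?_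
    · have := hr a
      rwa [mul_inv_rev, mul_assoc, mul_inv_cancel_left]
    · rw [← mul_assoc]
      exact h.2
  -- The multiplier depends only on the coset `K a`, and multiplication by it preserves that coset.
  -- So the image determines the multiplier, hence `a`.
  refine Nat.card_le_card_of_injective
    (fun a => (⟨κ (r a) (r a).2 * (a : G), hmem a⟩ : commonRoots n y z')) fun a a' h => ?_
  have h' : κ (r a) (r a).2 * (a : G) = κ (r a') (r a').2 * (a' : G) := congrArg Subtype.val h
  have hrel : S.r a a' := by
    rw [hS]
    have : (a' : G) * (a : G)⁻¹ = (κ (r a') (r a').2)⁻¹ * κ (r a) (r a).2 := by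
      rw [eq_inv_mul_iff_mul_eq, ← mul_assoc, ← h', mul_inv_cancel_right]
    rw [this]
    exact mul_mem (inv_mem (hκ _ _)) (hκ _ _)
  have hrr : r a = r a' := by
    simp only [r]
    rw [Quotient.sound (s := S) hrel]
  rw [hrr] at h'
  exact Subtype.ext (mul_left_cancel h')

end Roots

/-! ### Common roots in centralizers of commuting permutations -/

section Centralizer

theorem Equiv.Perm.apply_inv_apply {X : Type*} (p : Equiv.Perm X) (x : X) : p (p⁻¹ x) = x := by
  simp

/-- The equivariant permutations of a `Γ`-set that preserve every orbit. -/
def orbitwisePerm (Γ X : Type*) [CommGroup Γ] [MulAction Γ X] : Subgroup (Equiv.Perm X) where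
  carrier := {κ | (∀ (c : Γ) x, κ (c • x) = c • κ x) ∧ ∀ x, ∃ c : Γ, κ x = c • x}
  one_mem' := ⟨fun _ _ => rfl, fun x => ⟨1, by simp⟩⟩
  mul_mem' := by
    rintro κ κ' ⟨h₁, h₂⟩ ⟨h₁', h₂'⟩
    refine ⟨fun c x => by simp [h₁, h₁'], fun x => ?_⟩
    obtain ⟨c, hc⟩ := h₂' x
    obtain ⟨d, hd⟩ := h₂ x
    exact ⟨c * d, by rw [Equiv.Perm.mul_apply, hc, h₁, hd, smul_smul]⟩
  inv_mem' := by
    rintro κ ⟨h₁, h₂⟩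
    refine ⟨fun c x => ?_, fun x => ?_⟩
    · rw [Equiv.Perm.inv_eq_iff_eq, h₁, Equiv.Perm.apply_inv_apply]
    · obtain ⟨c, hc⟩ := h₂ (κ⁻¹ x)
      rw [Equiv.Perm.apply_inv_apply] at hc
      exact ⟨c⁻¹, by rw [eq_inv_smul_iff, ← hc]⟩

theorem orbitwisePerm_mul_comm {Γ X : Type*} [CommGroup Γ] [MulAction Γ X] {κ κ' : Equiv.Perm X}
    (hκ : κ ∈ orbitwisePerm Γ X) (hκ' : κ' ∈ orbitwisePerm Γ X) : κ * κ' = κ' * κ := by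
  ext x
  obtain ⟨c, hc⟩ := hκ.2 x
  obtain ⟨d, hd⟩ := hκ'.2 x
  rw [Equiv.Perm.mul_apply, Equiv.Perm.mul_apply, hd, hκ.1, hc, hκ'.1, hd, smul_comm]

theorem conj_mem_orbitwisePerm {Γ X : Type*} [CommGroup Γ] [MulAction Γ X] {κ a : Equiv.Perm X}
    (hκ : κ ∈ orbitwisePerm Γ X) (ha : ∀ (c : Γ) x, a (c • x) = c • a x) :
    a * κ * a⁻¹ ∈ orbitwisePerm Γ X := by
  have ha' : ∀ (c : Γ) x, a⁻¹ (c • x) = c • a⁻¹ x := fun c x => by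
    rw [Equiv.Perm.inv_eq_iff_eq, ha, Equiv.Perm.apply_inv_apply]
  refine ⟨fun c x => ?_, fun x => ?_⟩
  · simp only [Equiv.Perm.mul_apply, ha', hκ.1, ha]
  · obtain ⟨c, hc⟩ := hκ.2 (a⁻¹ x)
    refine ⟨c, ?_⟩
    rw [Equiv.Perm.mul_apply, Equiv.Perm.mul_apply, hc, ha, Equiv.Perm.apply_inv_apply]

variable {G X : Type*} [Group G] [Finite G] [Finite X] {D : Set (Equiv.Perm X)}

open scoped IsMulCommutative in
/-- In the centralizer of a commutative set of permutations, a power of `z` has at least as many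
common roots as `z`. -/
theorem card_commonRoots_le_zpow (hD : ∀ d ∈ D, ∀ d' ∈ D, d * d' = d' * d)
    {φ : G →* Equiv.Perm X} (hφ : Function.Injective φ)
    (hrange : φ.range = Subgroup.centralizer D) (n : ℕ) (y z : G) (j : ℤ) :
    Nat.card (commonRoots n y z) ≤ Nat.card (commonRoots n y (z ^ j)) := by
  have hmem : ∀ g, φ g ∈ Subgroup.centralizer D := fun g => hrange ▸ ⟨g, rfl⟩
  have hcomm : ∀ c ∈ insert (φ z) D, ∀ c' ∈ insert (φ z) D, c * c' = c' * c := by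
    rintro c (rfl | hc) c' (rfl | hc')
    · rfl
    · exact (Subgroup.mem_centralizer_iff.1 (hmem z) c' hc').symm
    · exact Subgroup.mem_centralizer_iff.1 (hmem z) c hc
    · exact hD c hc c' hc'
  have := Subgroup.isMulCommutative_closure hcomm
  -- Adjoining `z` to `D` keeps the group abelian, and every root of `z` still commutes with it.
  set Γ := Subgroup.closure (insert (φ z) D) with hΓ
  have hequiv : ∀ p : Equiv.Perm X, p ∈ Subgroup.centralizer (insert (φ z) D) →
      ∀ (c : Γ) x, p (c • x) = c • p x := by
    intro p hp c x
    rw [← Subgroup.centralizer_closure] at hp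
    exact (Equiv.congr_fun (Subgroup.mem_centralizer_iff.1 hp c c.2) x).symm
  have hroot : ∀ g : G, g ^ n = z → ∀ (c : Γ) x, φ g (c • x) = c • φ g x := by
    intro g hg
    refine hequiv _ (Subgroup.mem_centralizer_iff.2 ?_)
    rintro c (rfl | hc)
    · rw [← map_mul, ← map_mul, ← hg, ← pow_succ, ← pow_succ']
    · exact Subgroup.mem_centralizer_iff.1 (hmem g) c hc
  let zΓ : Γ := ⟨φ z, Subgroup.subset_closure (Set.mem_insert _ _)⟩
  refine card_commonRoots_le (K := (orbitwisePerm Γ X).comap φ) ?_ ?_ ?_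
  · intro κ hκ κ' hκ'
    apply hφ
    rw [map_mul, map_mul]
    exact orbitwisePerm_mul_comm hκ hκ'
  · rintro a ⟨ha, hay⟩ κ hκ
    constructor
    · have := conj_mem_orbitwisePerm hκ (hroot a ha)
      rwa [← map_mul, ← map_inv, ← map_mul] at this
    · have := conj_mem_orbitwisePerm hκ (hroot _ hay)
      rwa [← map_mul, ← map_inv, ← map_mul] at this
  · rintro a ⟨ha, hay⟩
    have hn : ∀ g : G, g ^ n = z → ∀ x, (φ g ^ n) x = zΓ • x := fun g hg x => by
      rw [← map_pow, hg]; rfl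
    -- The twist multiplies `z` by a power of `z`, so the exponent `j - 1` produces `z ^ j`.
    obtain ⟨κ, h₁, h₂, h₃, h₄⟩ :=
      exists_twist (hroot a ha) (hroot _ hay) (hn a ha) (hn _ hay) (j - 1)
    have hκ : κ ∈ φ.range := by
      rw [hrange, Subgroup.mem_centralizer_iff]
      intro d hd
      ext x
      exact (h₁ ⟨d, Subgroup.subset_closure (Set.mem_insert_of_mem _ hd)⟩ x).symm
    obtain ⟨k, rfl⟩ := hκ
    have hz : ∀ x, (zΓ * zΓ ^ (j - 1)) • x = φ (z ^ j) x := fun x => by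
      rw [← zpow_one_add, add_sub_cancel, map_zpow]
      rfl
    refine ⟨k, ⟨h₁, h₂⟩, hφ ?_, hφ ?_⟩
    · ext x
      rw [map_pow, map_mul, h₃, hz]
    · ext x
      rw [mul_assoc, map_pow, map_mul, h₄, hz]

/-- Raising to the power `j` is undone by a Bézout inverse of `j` modulo the group order, so the
inequality applies both ways. -/
theorem card_commonRoots_pow (hD : ∀ d ∈ D, ∀ d' ∈ D, d * d' = d' * d)
    {φ : G →* Equiv.Perm X} (hφ : Function.Injective φ)
    (hrange : φ.range = Subgroup.centralizer D) (n : ℕ) (y z : G) {j : ℕ}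
    (hj : (Nat.card G).Coprime j) :
    Nat.card (commonRoots n y (z ^ j)) = Nat.card (commonRoots n y z) := by
  refine le_antisymm ?_ ?_
  · have h := card_commonRoots_le_zpow hD hφ hrange n y (z ^ j) ((Nat.card G).gcdB j)
    rwa [show (z ^ j) ^ (Nat.card G).gcdB j = z from (powCoprime hj).left_inv z] at h
  · have h := card_commonRoots_le_zpow hD hφ hrange n y z j
    rwa [zpow_natCast] at h

end Centralizer

/-! ### The wreath product as a centralizer -/

section Wreath

variable {A : Type*} [CommGroup A] {N : ℕ}

instance : SMul (WreathProduct A N) (Fin N × A) where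
  smul g p := (g.right p.1, g.left (g.right p.1) * p.2)

theorem WreathProduct.smul_def (g : WreathProduct A N) (p : Fin N × A) :
    g • p = (g.right p.1, g.left (g.right p.1) * p.2) := rfl

instance : MulAction (WreathProduct A N) (Fin N × A) where
  one_smul _ := by simp [WreathProduct.smul_def]
  mul_smul g h p := by
    have : mulAutArrow g.right h.left (g.right (h.right p.1)) = h.left (h.right p.1) := by
      change h.left (g.right⁻¹ • g.right (h.right p.1)) = _
      simp
    simp [WreathProduct.smul_def, mul_assoc, this]

theorem WreathProduct.toPermHom_injective :
    Function.Injective (MulAction.toPermHom (WreathProduct A N) (Fin N × A)) := by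
  intro g h hgh
  have key : ∀ p : Fin N × A, g • p = h • p := fun p => Equiv.congr_fun hgh p
  have hr : g.right = h.right := by
    ext i
    have := congrArg Prod.fst (key (i, 1))
    simpa [WreathProduct.smul_def] using congrArg Fin.val this
  refine SemidirectProduct.ext ?_ hr
  funext i
  have := congrArg Prod.snd (key (g.right⁻¹ i, 1))
  simpa [WreathProduct.smul_def, ← hr] using this

/-- The wreath product is the centralizer of the translations by `A` on `Fin N × A`. -/
theorem WreathProduct.range_toPermHom :
    (MulAction.toPermHom (WreathProduct A N) (Fin N × A)).range =
      Subgroup.centralizer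
        (Set.range fun c : A => (Equiv.prodCongr (Equiv.refl (Fin N)) (Equiv.mulLeft c) :
          Equiv.Perm (Fin N × A))) := by
  ext p
  rw [Subgroup.mem_centralizer_iff]
  constructor
  · rintro ⟨g, rfl⟩ _ ⟨c, rfl⟩
    ext q <;> simp [WreathProduct.smul_def, mul_left_comm]
  · intro hp
    have hp' : ∀ (c : A) i x, p (i, c * x) = ((p (i, x)).1, c * (p (i, x)).2) := fun c i x =>
      (Equiv.congr_fun (hp _ ⟨c, rfl⟩) (i, x)).symm
    have hfst : ∀ i x, p (i, x) = ((p (i, 1)).1, x * (p (i, 1)).2) := fun i x => by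
      rw [← hp', mul_one]
    have hsurj : Function.Surjective fun i => (p (i, 1)).1 := by
      intro i
      obtain ⟨⟨i', x⟩, h⟩ := p.surjective (i, 1)
      exact ⟨i', by rw [hfst] at h; exact congrArg Prod.fst h⟩
    let σ : Equiv.Perm (Fin N) :=
      Equiv.ofBijective (fun i => (p (i, 1)).1) (Finite.surjective_iff_bijective.1 hsurj)
    have hσ : ∀ i, σ i = (p (i, 1)).1 := fun i => rfl
    -- The action reads `left` at the target index, hence the `σ⁻¹`.
    refine ⟨⟨fun i => (p (σ⁻¹ i, 1)).2, σ⟩, ?_⟩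
    ext1 ⟨i, x⟩
    have hinv : σ⁻¹ (p (i, 1)).1 = i := by rw [← hσ]; simp
    rw [hfst i x]
    simp only [MulAction.toPermHom_apply, MulAction.toPerm_apply, WreathProduct.smul_def, hinv,
      mul_comm, hσ]

theorem WreathProduct.card_commonRoots_pow [Finite A] (n : ℕ) (y z : WreathProduct A N) {j : ℕ}
    (hj : (Nat.card (WreathProduct A N)).Coprime j) :
    Nat.card (commonRoots n y (z ^ j)) = Nat.card (commonRoots n y z) := by
  refine _root_.card_commonRoots_pow ?_ WreathProduct.toPermHom_injective
    WreathProduct.range_toPermHom n y z hj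
  rintro _ ⟨c, rfl⟩ _ ⟨c', rfl⟩
  ext q <;> simp [mul_left_comm]

end Wreath

/-! ### Sweedler powers and the normalized integral -/

section SweedlerPower

variable (k : Type*) [CommRing k] {H : Type*} [Ring H] [HopfAlgebra k H]

/-- The Sweedler power `h ↦ h₁ ⋯ hₙ`. -/
noncomputable def sweedlerPower (n : ℕ) : H →ₗ[k] H := iteratedMul k n ∘ₗ iteratedComul k n

theorem sweedlerPower_zero (h : H) :
    sweedlerPower k 0 h = Coalgebra.counit (R := k) h • (1 : H) := by
  simp only [sweedlerPower, iteratedComul, LinearMap.comp_apply, LinearEquiv.coe_coe,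
    TensorPower.algebraMap₀_eq_smul_one, map_smul, TensorPower.gOne_def, iteratedMul,
    PiTensorProduct.lift.tprod, MultilinearMap.mkPiAlgebraFin_apply]
  simp

theorem iteratedMul_mulEquiv_tmul (n : ℕ) (x : ⨂[k]^n H) (h : H) :
    iteratedMul k (n + 1) (TensorPower.mulEquiv (R := k) (M := H) (n := n) (m := 1) (x ⊗ₜ[k]
      (PiTensorProduct.subsingletonEquiv (R := k) (s := fun _ : Fin 1 => H) 0).symm h)) =
      iteratedMul k n x * h := by
  induction x using PiTensorProduct.induction_on with
  | smul_tprod r f =>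
    have h₁ : (PiTensorProduct.subsingletonEquiv (R := k) (s := fun _ : Fin 1 => H) 0).symm h =
        PiTensorProduct.tprod k (fun _ : Fin 1 => h) :=
      PiTensorProduct.subsingletonEquiv_symm_apply' (R := k) (0 : Fin 1) h
    have h₂ := TensorPower.tprod_mul_tprod k f (fun _ : Fin 1 => h)
    rw [TensorPower.gMul_def] at h₂
    rw [h₁, ← TensorProduct.smul_tmul', map_smul, map_smul, h₂]
    simp only [iteratedMul, map_smul, PiTensorProduct.lift.tprod,
      MultilinearMap.mkPiAlgebraFin_apply, List.ofFn_fin_append]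
    simp
  | add x y hx hy => rw [TensorProduct.add_tmul, map_add, map_add, hx, hy, map_add, add_mul]

theorem sweedlerPower_succ (n : ℕ) (h : H) :
    sweedlerPower k (n + 1) h = LinearMap.mul' k H
      (TensorProduct.map (sweedlerPower k n) LinearMap.id (Coalgebra.comul (R := k) h)) := by
  simp only [sweedlerPower, iteratedComul, LinearMap.comp_apply]
  generalize (Coalgebra.comul (R := k) h) = t
  induction t using TensorProduct.induction_on with
  | zero => simp
  | add x y hx hy => simp only [map_add, hx, hy]
  | tmul x y =>
    simp only [TensorProduct.map_tmul, LinearEquiv.coe_coe, iteratedMul_mulEquiv_tmul,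
      LinearMap.mul'_apply, LinearMap.comp_apply, LinearMap.id_apply]

theorem frobeniusSchurIndicator_eq_trace_sweedlerPower (Λ : H) (V : Type*) [AddCommGroup V]
    [Module k V] [Module H V] [IsScalarTower k H V] (n : ℕ) :
    frobeniusSchurIndicator k Λ V n =
      LinearMap.trace k V (Algebra.lsmul k k V (sweedlerPower k n Λ)) := rfl

end SweedlerPower

theorem List.prod_ofFn_snoc {G M : Type*} [Monoid M] {n : ℕ} (f : G → M) (u : Fin n → G) (w : G) :
    (List.ofFn fun i => f (Fin.snoc (α := fun _ => G) u w i)).prod =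
      (List.ofFn fun i => f (u i)).prod * f w := by
  rw [List.ofFn_succ', List.concat_eq_append, List.prod_append]
  simp

namespace QuantumDouble

variable {k G : Type*} [CommRing k] [Group G] [Fintype G]

theorem sweedlerPower_succ_gδ (n : ℕ) (g x : G) :
    sweedlerPower k (n + 1) (gδ k g x) =
      ∑ u : G, sweedlerPower k n (gδ k g u) * gδ k g (u⁻¹ * x) := by
  rw [sweedlerPower_succ, comul_gδ]
  simp

-- A product of factors `g δ_{u_i}` vanishes unless `u_{i+1} = g⁻¹ u_i g`, so the last index `y`
-- determines all others, and their product is then `g ^ n * (g⁻¹ * y) ^ n`.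
open Classical in
theorem sweedlerPower_gδ (n : ℕ) (g x : G) :
    sweedlerPower k n (gδ k g x) =
      ∑ y : G, if g ^ n * (g⁻¹ * y) ^ n = x then gδ k (g ^ n) y else 0 := by
  induction n generalizing x with
  | zero =>
    rw [sweedlerPower_zero, counit_gδ, one_def]
    by_cases hx : x = 1
    · simp [hx]
    · simp [hx, Ne.symm hx]
  | succ n ih =>
    rw [sweedlerPower_succ_gδ]
    simp only [ih, Finset.sum_mul, ite_mul, zero_mul]
    rw [Finset.sum_comm]
    simp only [Finset.sum_ite_eq, Finset.mem_univ, if_true, gδ_mul_gδ]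
    -- The old last index `y` forces the new last index to be `g⁻¹ * y * g`.
    refine Fintype.sum_equiv (MulAut.conj g⁻¹).toEquiv _ _ fun y => ?_
    have h₁ : (MulAut.conj g⁻¹).toEquiv y = g⁻¹ * y * g := by simp
    have h₂ : g ^ (n + 1) * (g⁻¹ * (g⁻¹ * y * g)) ^ (n + 1) =
        g ^ n * (g⁻¹ * y) ^ n * (g⁻¹ * y * g) := by
      have : g⁻¹ * (g⁻¹ * y * g) = g⁻¹ * (g⁻¹ * y) * g⁻¹⁻¹ := by group
      rw [this, conj_pow, pow_succ, pow_succ]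
      group
    rw [h₁, h₂, ← pow_succ]
    by_cases h : g⁻¹ * y * g = (g ^ n * (g⁻¹ * y) ^ n)⁻¹ * x
    · rw [if_pos h, h, if_pos]
      group
    · rw [if_neg h, if_neg]
      intro h'
      exact h (by rw [← h']; group)

open Classical in
theorem sweedlerPower_gδ_eq_sum_list_prod (n : ℕ) (g x : G) :
    sweedlerPower k n (gδ k g x) =
      ∑ u : Fin n → G, if (List.ofFn u).prod = x then
        (List.ofFn fun i => gδ k g (u i)).prod else 0 := by
  induction n generalizing x with
  | zero =>
    rw [sweedlerPower_zero, counit_gδ]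
    by_cases hx : x = 1
    · simp [hx]
    · simp [hx, Ne.symm hx]
  | succ n ih =>
    rw [sweedlerPower_succ_gδ]
    simp only [ih, Finset.sum_mul, ite_mul, zero_mul]
    rw [Finset.sum_comm]
    simp only [Finset.sum_ite_eq, Finset.mem_univ, if_true]
    rw [← (Fin.snocEquiv fun _ : Fin (n + 1) => G).sum_comp, Fintype.sum_prod_type, Finset.sum_comm]
    refine Finset.sum_congr rfl fun u _ => ?_
    have h₁ : ∀ w, (List.ofFn (Fin.snocEquiv (fun _ : Fin (n + 1) => G) (w, u))).prod =
        (List.ofFn u).prod * w := fun w => List.prod_ofFn_snoc id u w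
    have h₂ : ∀ w, (List.ofFn fun i =>
        gδ k g (Fin.snocEquiv (fun _ : Fin (n + 1) => G) (w, u) i)).prod =
        (List.ofFn fun i => gδ k g (u i)).prod * gδ k g w := fun w =>
      List.prod_ofFn_snoc (gδ k g) u w
    simp only [h₁, h₂, ← eq_inv_mul_iff_mul_eq, Finset.sum_ite_eq', Finset.mem_univ, if_true]

/-- A normalized left integral of `D(G)` is `|G|⁻¹ (∑_g g) δ_1`. -/
theorem eq_of_isLeftIntegral {Λ : QuantumDouble ℂ G} (hΛ : IsLeftIntegral ℂ Λ)
    (hΛ₁ : Coalgebra.counit (R := ℂ) Λ = 1) :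
    Λ = (Fintype.card G : ℂ)⁻¹ • ∑ g : G, gδ ℂ g 1 := by
  classical
  set Λ₀ : QuantumDouble ℂ G := (Fintype.card G : ℂ)⁻¹ • ∑ g : G, gδ ℂ g 1 with hΛ₀
  have h₁ : Λ₀ * Λ = Λ := by
    rw [hΛ]
    simp [hΛ₀, counit_gδ]
  have h₂ : ∀ a : QuantumDouble ℂ G, Λ₀ * a = Coalgebra.counit (R := ℂ) a • Λ₀ := by
    intro a
    rw [hΛ₀, smul_mul_assoc, smul_comm]
    congr 1
    induction a using induction_on with
    | zero => simp
    | add a a' h h' => simp only [map_add, mul_add, add_smul, h, h']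
    | smul r a h => simp only [map_smul, mul_smul_comm, smul_assoc, h]
    | basis g x =>
      rw [Finset.sum_mul, counit_gδ]
      simp only [gδ_mul_gδ, mul_one, inv_mul_cancel]
      by_cases hx : x = 1
      · subst hx
        simp only [if_true, one_smul]
        exact Fintype.sum_equiv (Equiv.mulRight g) _ _ fun v => rfl
      · simp [hx, Ne.symm hx]
  rw [← h₁, h₂, hΛ₁, one_smul]

end QuantumDouble

/-! ### Integrality of the indicators via the cyclic shift -/

section CyclicTrace

variable {ι R : Type*} [CommRing R]

theorem list_prod_ofFn_apply_eq_sum [Fintype ι] [DecidableEq ι] {m : ℕ}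
    (M : Fin (m + 1) → Matrix ι ι R) (x y : ι) :
    (List.ofFn M).prod x y = ∑ a : Fin m → ι, ∏ i : Fin (m + 1),
      M i (Fin.cons (α := fun _ => ι) x a i) (Fin.snoc (α := fun _ => ι) a y i) := by
  induction m generalizing x with
  | zero => simp [Fin.snoc]
  | succ m ih =>
    rw [List.ofFn_succ, List.prod_cons, Matrix.mul_apply]
    simp only [ih, Finset.mul_sum]
    rw [← (Fin.consEquiv fun _ : Fin (m + 1) => ι).sum_comp, Fintype.sum_prod_type]
    refine Finset.sum_congr rfl fun w _ => Finset.sum_congr rfl fun a _ => ?_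
    have h : (Fin.consEquiv (fun _ : Fin (m + 1) => ι)) (w, a) = Fin.cons w a := rfl
    rw [h, ← Fin.cons_snoc_eq_snoc_cons]
    symm
    exact Fin.prod_univ_succ _

/-- The right side is the trace of the tensor product of the matrices composed with a cyclic shift
of the factors. -/
theorem trace_list_prod_ofFn [Fintype ι] [DecidableEq ι] {m : ℕ} (M : Fin (m + 1) → Matrix ι ι R) :
    (List.ofFn M).prod.trace =
      ∑ a : Fin (m + 1) → ι, ∏ i, M i (a i) (a (finRotate (m + 1) i)) := by
  simp only [Matrix.trace, Matrix.diag, list_prod_ofFn_apply_eq_sum]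
  rw [← (Fin.consEquiv fun _ : Fin (m + 1) => ι).sum_comp, Fintype.sum_prod_type]
  refine Finset.sum_congr rfl fun w _ => Finset.sum_congr rfl fun a _ => ?_
  rw [Fin.snoc_eq_cons_rotate]
  rfl

/-- The matrix of the tensor product of a family of matrices. -/
def kroneckerPi {n : ℕ} (M : Fin n → Matrix ι ι R) : Matrix (Fin n → ι) (Fin n → ι) R :=
  Matrix.of fun a b => ∏ i, M i (a i) (b i)

theorem kroneckerPi_mul [Fintype ι] {n : ℕ} (M M' : Fin n → Matrix ι ι R) :
    kroneckerPi M * kroneckerPi M' = kroneckerPi fun i => M i * M' i := by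
  ext a c
  simp only [kroneckerPi, Matrix.mul_apply, Matrix.of_apply, Finset.prod_univ_sum,
    Fintype.piFinset_univ, Finset.prod_mul_distrib]

theorem kroneckerPi_eq_zero {n : ℕ} {M : Fin n → Matrix ι ι R} {i : Fin n} (h : M i = 0) :
    kroneckerPi M = 0 := by
  ext a b
  exact Finset.prod_eq_zero (Finset.mem_univ i) (by simp [h])

/-- Every eigenvalue is a root of the monic polynomial `X ^ (k + 1) - X`. -/
theorem isIntegral_trace_of_pow_succ_eq_self [Fintype ι] [DecidableEq ι] {M : Matrix ι ι ℂ}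
    {k : ℕ} (hk : 0 < k) (hM : M ^ (k + 1) = M) : IsIntegral ℤ M.trace := by
  rw [Matrix.trace_eq_sum_roots_charpoly]
  refine IsIntegral.multiset_sum fun r hr => ?_
  have hr' : r ∈ spectrum ℂ M :=
    Matrix.mem_spectrum_of_isRoot_charpoly (Polynomial.isRoot_of_mem_roots hr)
  have h := spectrum.subset_polynomial_aeval M
    (Polynomial.X ^ (k + 1) - Polynomial.X : Polynomial ℂ) ⟨r, hr', rfl⟩
  have h₀ : Polynomial.aeval M (Polynomial.X ^ (k + 1) - Polynomial.X : Polynomial ℂ) = 0 := by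
    simp [hM]
  rw [h₀] at h
  have : Nonempty ι := by
    by_contra hι
    rw [not_nonempty_iff] at hι
    exact hr' (isUnit_of_subsingleton _)
  rw [spectrum.zero_eq, Set.mem_singleton_iff] at h
  refine ⟨Polynomial.X ^ (k + 1) - Polynomial.X, ?_, ?_⟩
  · exact Polynomial.monic_X_pow_sub (by
      rw [Polynomial.degree_X]
      exact_mod_cast Nat.lt_add_of_pos_left hk)
  · simpa using h

theorem prod_ofFn_conj {G : Type*} [Group G] {n : ℕ} (h : G) (v : Fin n → G) :
    (List.ofFn fun i => h * v i * h⁻¹).prod = h * (List.ofFn v).prod * h⁻¹ := by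
  have := map_list_prod (MulAut.conj h) (List.ofFn v)
  rw [List.map_ofFn] at this
  exact this.symm

theorem prod_ofFn_comp_finRotate_eq_one_iff {G : Type*} [Group G] {m : ℕ}
    (u : Fin (m + 1) → G) :
    (List.ofFn (u ∘ finRotate (m + 1))).prod = 1 ↔ (List.ofFn u).prod = 1 := by
  obtain ⟨⟨w, v⟩, rfl⟩ := (Fin.consEquiv fun _ : Fin (m + 1) => G).surjective u
  have h₁ : (Fin.consEquiv fun _ : Fin (m + 1) => G) (w, v) ∘ finRotate (m + 1) =
      Fin.snoc (α := fun _ => G) v w := (Fin.snoc_eq_cons_rotate v w).symm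
  have h₂ : (List.ofFn (Fin.snoc (α := fun _ => G) v w)).prod = (List.ofFn v).prod * w :=
    List.prod_ofFn_snoc id v w
  have h₃ : (List.ofFn ((Fin.consEquiv fun _ : Fin (m + 1) => G) (w, v))).prod =
      w * (List.ofFn v).prod := by
    rw [List.ofFn_succ, List.prod_cons]
    rfl
  rw [h₁, h₂, h₃, mul_eq_one_comm]

end CyclicTrace

namespace QuantumDouble

variable {G : Type*} [Group G] [Fintype G] {ι : Type*} [Fintype ι] [DecidableEq ι]

open Classical in
/-- The action of `Δₙ(g δ₁)` on the `n`-th tensor power of a matrix representation. -/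
noncomputable def tensorMatrix (ρ : QuantumDouble ℂ G →ₐ[ℂ] Matrix ι ι ℂ) (n : ℕ) (g : G) :
    Matrix (Fin n → ι) (Fin n → ι) ℂ :=
  ∑ u : Fin n → G, if (List.ofFn u).prod = 1 then kroneckerPi fun i => ρ (gδ ℂ g (u i)) else 0

theorem tensorMatrix_mul (ρ : QuantumDouble ℂ G →ₐ[ℂ] Matrix ι ι ℂ) (n : ℕ) (g h : G) :
    tensorMatrix ρ n g * tensorMatrix ρ n h = tensorMatrix ρ n (g * h) := by
  classical
  unfold tensorMatrix
  rw [Finset.sum_mul_sum, Finset.sum_comm]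
  refine Finset.sum_congr rfl fun v _ => ?_
  -- Only the conjugated tuple has a nonzero product with the tuple `v` in every tensor factor.
  rw [Finset.sum_eq_single fun i => h * v i * h⁻¹]
  · have hcond : (List.ofFn fun i => h * v i * h⁻¹).prod = 1 ↔ (List.ofFn v).prod = 1 := by
      rw [prod_ofFn_conj, conj_eq_one_iff]
    by_cases hv : (List.ofFn v).prod = 1
    · rw [if_pos hv, if_pos (hcond.2 hv), if_pos hv, kroneckerPi_mul]
      congr 1
      funext i
      rw [← map_mul, gδ_mul_gδ, if_pos (by group)]
    · rw [if_neg hv, if_neg hv, mul_zero]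
  · intro u _ hu
    obtain ⟨i, hi⟩ := Function.ne_iff.1 hu
    split_ifs <;> try simp only [zero_mul, mul_zero]
    rw [kroneckerPi_mul]
    refine kroneckerPi_eq_zero (i := i) ?_
    rw [← map_mul, gδ_mul_gδ, if_neg, map_zero]
    intro h'
    apply hi
    rw [← h']
    group
  · simp

/-- The condition that a product equals `1` is invariant under cyclic rotation of its factors. -/
theorem tensorMatrix_submatrix_rotate (ρ : QuantumDouble ℂ G →ₐ[ℂ] Matrix ι ι ℂ) (m : ℕ) (g : G) :
    (tensorMatrix ρ (m + 1) g).submatrix (fun a => a ∘ finRotate (m + 1))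
      (fun a => a ∘ finRotate (m + 1)) = tensorMatrix ρ (m + 1) g := by
  classical
  ext a b
  simp only [tensorMatrix, Matrix.submatrix_apply, Matrix.sum_apply]
  symm
  refine Fintype.sum_equiv (Equiv.arrowCongr (finRotate (m + 1)).symm (Equiv.refl G)) _ _
    fun u => ?_
  have hu : (Equiv.arrowCongr (finRotate (m + 1)).symm (Equiv.refl G)) u =
    u ∘ finRotate (m + 1) := rfl
  rw [hu]
  simp only [prod_ofFn_comp_finRotate_eq_one_iff]
  split_ifs
  · simp only [kroneckerPi, Matrix.of_apply, Function.comp_apply]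
    exact (Equiv.prod_comp (finRotate (m + 1)) fun i => ρ (gδ ℂ g (u i)) (a i) (b i)).symm
  · rfl

theorem isIntegral_trace_sweedlerPower (ρ : QuantumDouble ℂ G →ₐ[ℂ] Matrix ι ι ℂ) (m : ℕ) :
    IsIntegral ℤ (ρ (sweedlerPower ℂ (m + 1)
      ((Fintype.card G : ℂ)⁻¹ • ∑ g : G, gδ ℂ g 1))).trace := by
  classical
  set P : Matrix (Fin (m + 1) → ι) (Fin (m + 1) → ι) ℂ :=
    (Fintype.card G : ℂ)⁻¹ • ∑ g : G, tensorMatrix ρ (m + 1) g with hP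
  have hPP : P * P = P := by
    have hsum : ∀ g : G, ∑ h : G, tensorMatrix ρ (m + 1) (g * h) =
        ∑ h : G, tensorMatrix ρ (m + 1) h := fun g =>
      Fintype.sum_equiv (Equiv.mulLeft g) _ _ fun h => rfl
    rw [hP, Matrix.smul_mul, Matrix.mul_smul, Finset.sum_mul_sum]
    simp only [tensorMatrix_mul, hsum, Finset.sum_const, Finset.card_univ]
    rw [← Nat.cast_smul_eq_nsmul ℂ, inv_smul_smul₀]
    exact_mod_cast Fintype.card_ne_zero
  let e : Equiv.Perm (Fin (m + 1) → ι) :=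
    Equiv.arrowCongr (finRotate (m + 1)).symm (Equiv.refl ι)
  have he : ∀ a, e a = a ∘ finRotate (m + 1) := fun a => rfl
  have hPe : P.submatrix e e = P := by
    ext a b
    simp only [hP, Matrix.submatrix_apply, Matrix.smul_apply, Matrix.sum_apply]
    congr 1
    exact Finset.sum_congr rfl fun g _ => congrFun₂ (tensorMatrix_submatrix_rotate ρ m g) a b
  let C : Matrix (Fin (m + 1) → ι) (Fin (m + 1) → ι) ℂ :=
    Equiv.Perm.permMatrix ℂ e⁻¹
  have hPC : P * C = P.submatrix id e := PEquiv.mul_toMatrix_toPEquiv P e⁻¹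
  have hCP : C * P = P.submatrix e.symm id := PEquiv.toMatrix_toPEquiv_mul e⁻¹ P
  have hcomm : Commute P C := by
    rw [Commute, SemiconjBy, hPC, hCP]
    conv_rhs => rw [← hPe]
    ext a b
    simp
  have hC : C ^ orderOf e = 1 := by
    have : C = Matrix.permMatrixHom e := rfl
    rw [this, ← map_pow, pow_orderOf_eq_one, map_one]
  have hpos : 0 < orderOf e := orderOf_pos e
  have hPpow : ∀ j : ℕ, P ^ (j + 1) = P := fun j => IsIdempotentElem.pow_succ_eq j hPP
  have hQ : (P * C) ^ (orderOf e + 1) = P * C := by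
    rw [hcomm.mul_pow, hPpow, pow_succ, hC, one_mul]
  have htrace : (P * C).trace = (ρ (sweedlerPower ℂ (m + 1)
      ((Fintype.card G : ℂ)⁻¹ • ∑ g : G, gδ ℂ g 1))).trace := by
    rw [hPC]
    simp only [map_smul, map_sum, Matrix.trace_smul, Matrix.trace_sum,
      sweedlerPower_gδ_eq_sum_list_prod]
    simp only [Matrix.trace, Matrix.diag, Matrix.submatrix_apply, hP, Matrix.smul_apply,
      Matrix.sum_apply, tensorMatrix, id_eq]
    rw [← Finset.smul_sum, Finset.sum_comm]
    congr 1
    refine Finset.sum_congr rfl fun g _ => ?_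
    rw [Finset.sum_comm]
    refine Finset.sum_congr rfl fun u _ => ?_
    split_ifs
    · rw [map_list_prod, List.map_ofFn]
      exact (trace_list_prod_ofFn _).symm
    · simp
  rw [← htrace]
  exact isIntegral_trace_of_pow_succ_eq_self hpos hQ

/-- Frobenius–Schur indicators are algebraic integers. -/
theorem isIntegral_frobeniusSchurIndicator {Λ : QuantumDouble ℂ G} (hΛ : IsLeftIntegral ℂ Λ)
    (hΛ₁ : Coalgebra.counit (R := ℂ) Λ = 1) (V : Type*) [AddCommGroup V] [Module ℂ V]
    [Module (QuantumDouble ℂ G) V] [IsScalarTower ℂ (QuantumDouble ℂ G) V]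
    [FiniteDimensional ℂ V] (n : ℕ) :
    IsIntegral ℤ (frobeniusSchurIndicator ℂ Λ V n) := by
  rw [frobeniusSchurIndicator_eq_trace_sweedlerPower]
  cases n with
  | zero =>
    rw [sweedlerPower_zero, hΛ₁, one_smul, map_one, LinearMap.trace_one]
    exact isIntegral_algebraMap (R := ℤ) (x := (Module.finrank ℂ V : ℤ))
  | succ m =>
    let b := Module.finBasis ℂ V
    have h := isIntegral_trace_sweedlerPower
      ((LinearMap.toMatrixAlgEquiv b).toAlgHom.comp (Algebra.lsmul ℂ ℂ V)) m (G := G)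
    rw [← eq_of_isLeftIntegral hΛ hΛ₁] at h
    rw [LinearMap.trace_eq_matrix_trace ℂ b]
    exact h

end QuantumDouble

/-! ### Rational traces from sums over generators of a cyclic group -/

section CoprimeSums

theorem sum_range_filter_dvd {R : Type*} [AddCommMonoid R] {E d : ℕ} (hd : d ∣ E) (hE : E ≠ 0)
    (F : ℕ → R) :
    ∑ j ∈ Finset.range E with d ∣ j, F j = ∑ i ∈ Finset.range (E / d), F (d * i) := by
  obtain ⟨m, rfl⟩ := hd
  have hd : 0 < d := Nat.pos_of_ne_zero (left_ne_zero_of_mul hE)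
  rw [Nat.mul_div_cancel_left m hd]
  symm
  refine Finset.sum_bij (fun i _ => d * i) ?_ ?_ ?_ ?_
  · intro i hi
    simp only [Finset.mem_filter, Finset.mem_range] at hi ⊢
    exact ⟨Nat.mul_lt_mul_of_pos_left hi hd, dvd_mul_right d i⟩
  · intro i _ j _ h
    exact Nat.eq_of_mul_eq_mul_left hd h
  · intro j hj
    simp only [Finset.mem_filter, Finset.mem_range] at hj
    obtain ⟨hj, i, rfl⟩ := hj
    exact ⟨i, Finset.mem_range.2 (Nat.lt_of_mul_lt_mul_left hj), rfl⟩
  · intro i _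
    rfl

open scoped ArithmeticFunction.Moebius in
/-- Möbius inversion for a sum over the residues prime to the modulus. -/
theorem sum_coprime_eq_sum_divisors {R : Type*} [AddCommGroup R] {E : ℕ} (hE : E ≠ 0)
    (F : ℕ → R) :
    ∑ j ∈ Finset.range E with E.Coprime j, F j =
      ∑ d ∈ E.divisors, μ d • ∑ i ∈ Finset.range (E / d), F (d * i) := by
  have h₁ : ∀ j, (if E.Coprime j then F j else 0) =
      ∑ d ∈ E.divisors, if d ∣ j then μ d • F j else 0 := by
    intro j
    have hg : E.gcd j ≠ 0 := Nat.gcd_ne_zero_left hE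
    have hdiv : (E.gcd j).divisors = E.divisors.filter (· ∣ j) := by
      ext d
      simp [Nat.dvd_gcd_iff, hE, hg]
    rw [← Finset.sum_filter, ← hdiv, ← Finset.sum_smul, ← ArithmeticFunction.coe_mul_zeta_apply,
      ArithmeticFunction.moebius_mul_coe_zeta, ArithmeticFunction.one_apply, ite_smul, one_smul,
      zero_smul]
  rw [Finset.sum_filter]
  simp only [h₁]
  rw [Finset.sum_comm]
  refine Finset.sum_congr rfl fun d hd => ?_
  rw [← sum_range_filter_dvd (Nat.dvd_of_mem_divisors hd) hE, ← Finset.sum_filter, Finset.smul_sum]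

theorem sum_range_add_of_periodic {R : Type*} [AddCommGroup R] {f : ℕ → R} {m : ℕ}
    (hf : ∀ i, f (i + m) = f i) (k : ℕ) :
    ∑ i ∈ Finset.range m, f (k + i) = ∑ i ∈ Finset.range m, f i := by
  induction k with
  | zero => simp
  | succ k ih =>
    rw [← ih]
    have h₁ := Finset.sum_range_succ' (fun i => f (k + i)) m
    have h₂ := Finset.sum_range_succ (fun i => f (k + i)) m
    rw [hf, h₁, add_zero] at h₂
    have := add_right_cancel h₂
    rw [← this]
    exact Finset.sum_congr rfl fun i _ => by rw [add_right_comm, add_assoc]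

variable {V : Type*} [AddCommGroup V] [Module ℂ V] [FiniteDimensional ℂ V]

/-- `f / m` is idempotent, so its trace is its rank. -/
theorem trace_mem_rat_of_mul_self_eq_smul {f : Module.End ℂ V} {m : ℕ} (hm : m ≠ 0)
    (h : f * f = m • f) : LinearMap.trace ℂ V f ∈ (algebraMap ℚ ℂ).fieldRange := by
  have hm' : (m : ℂ) ≠ 0 := by exact_mod_cast hm
  have he : IsIdempotentElem ((m : ℂ)⁻¹ • f) := by
    rw [IsIdempotentElem, smul_mul_smul_comm, h, ← Nat.cast_smul_eq_nsmul ℂ, smul_smul, mul_assoc,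
      inv_mul_cancel₀ hm', mul_one]
  have ht := (LinearMap.IsIdempotentElem.isProj_range _ he).trace
  rw [map_smul, smul_eq_mul, inv_mul_eq_iff_eq_mul₀ hm'] at ht
  rw [ht]
  exact mul_mem (natCast_mem _ _) (natCast_mem _ _)

/-- If `p` is a homomorphism of a cyclic group of order `E` to a corner of the endomorphism ring,
then the sum of the traces of the generators is rational. -/
theorem sum_coprime_trace_mem_rat {p : ℕ → Module.End ℂ V} {E : ℕ} (hE : E ≠ 0)
    (hmul : ∀ i j, p i * p j = p (i + j)) (hper : ∀ i, p (i + E) = p i) :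
    ∑ j ∈ Finset.range E with E.Coprime j, LinearMap.trace ℂ V (p j) ∈
      (algebraMap ℚ ℂ).fieldRange := by
  rw [sum_coprime_eq_sum_divisors hE]
  refine sum_mem fun d hd => zsmul_mem ?_ _
  obtain ⟨m, rfl⟩ := Nat.dvd_of_mem_divisors hd
  have hd0 : 0 < d := Nat.pos_of_ne_zero (left_ne_zero_of_mul hE)
  rw [Nat.mul_div_cancel_left m hd0, ← map_sum]
  refine trace_mem_rat_of_mul_self_eq_smul (right_ne_zero_of_mul hE) ?_
  -- The sum over the multiples of `d` absorbs each of its `m` terms, so its square is `m` times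
  -- itself.
  rw [Finset.sum_mul_sum]
  simp only [hmul, ← mul_add]
  simp only [sum_range_add_of_periodic (f := fun i => p (d * i)) (m := m)
    (fun i => by rw [mul_add, hper])]
  simp

end CoprimeSums

/-! ### Rationality of the indicators -/

namespace QuantumDouble

variable {G : Type*} [Group G] [Fintype G] {V : Type*} [AddCommGroup V] [Module ℂ V]
    [Module (QuantumDouble ℂ G) V] [IsScalarTower ℂ (QuantumDouble ℂ G) V]

/-- With `a = g⁻¹`, the condition in `sweedlerPower_gδ` at `x = 1` reads `(a * y) ^ n = a ^ n`;
collecting terms by this common value `z` gives the formula. -/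
theorem frobeniusSchurIndicator_eq_sum {Λ : QuantumDouble ℂ G} (hΛ : IsLeftIntegral ℂ Λ)
    (hΛ₁ : Coalgebra.counit (R := ℂ) Λ = 1) (n : ℕ) :
    frobeniusSchurIndicator ℂ Λ V n = (Fintype.card G : ℂ)⁻¹ * ∑ y : G, ∑ z : G,
      (Nat.card (commonRoots n y z) : ℂ) *
        LinearMap.trace ℂ V (Algebra.lsmul ℂ ℂ V (gδ ℂ z⁻¹ y)) := by
  classical
  rw [frobeniusSchurIndicator_eq_trace_sweedlerPower, eq_of_isLeftIntegral hΛ hΛ₁]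
  simp only [map_smul, map_sum, smul_eq_mul, sweedlerPower_gδ]
  congr 1
  rw [Finset.sum_comm]
  refine Finset.sum_congr rfl fun y _ => ?_
  have hcard : ∀ z, (Nat.card (commonRoots n y z) : ℂ) =
      ∑ a : G, if a ^ n = z ∧ (a * y) ^ n = z then (1 : ℂ) else 0 := by
    intro z
    rw [Finset.sum_boole, Nat.card_eq_fintype_card, Fintype.card_subtype]
    congr 2
    ext a
    simp only [Finset.mem_filter, Finset.mem_univ, true_and]
    exact Iff.rfl
  simp only [hcard, Finset.sum_mul]
  rw [Finset.sum_comm]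
  refine Fintype.sum_equiv (Equiv.inv G) _ _ fun g => ?_
  rw [Finset.sum_eq_single ((g⁻¹) ^ n)]
  · by_cases h : (g⁻¹ * y) ^ n = (g⁻¹) ^ n
    · rw [if_pos (by rw [h, inv_pow, mul_inv_cancel]), Equiv.inv_apply, if_pos ⟨rfl, h⟩, one_mul]
      simp
    · rw [if_neg, Equiv.inv_apply, if_neg fun h' => h h'.2]
      · simp
      · intro h'
        exact h (by rw [inv_pow, eq_inv_of_mul_eq_one_right h'])
  · intro z _ hz
    rw [Equiv.inv_apply, if_neg fun h => hz h.1.symm, zero_mul]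
  · simp

/-- The indicators are rational if the numbers of common roots do not change when `z` is replaced
by another generator of the cyclic group generated by `z`. -/
theorem frobeniusSchurIndicator_mem_rat [FiniteDimensional ℂ V] {Λ : QuantumDouble ℂ G}
    (hΛ : IsLeftIntegral ℂ Λ) (hΛ₁ : Coalgebra.counit (R := ℂ) Λ = 1) (n : ℕ)
    (hcard : ∀ (y z : G) (j : ℕ), (Nat.card G).Coprime j →
      Nat.card (commonRoots n y (z ^ j)) = Nat.card (commonRoots n y z)) :
    frobeniusSchurIndicator ℂ Λ V n ∈ (algebraMap ℚ ℂ).fieldRange := by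
  classical
  rw [frobeniusSchurIndicator_eq_sum hΛ hΛ₁]
  refine mul_mem (inv_mem (natCast_mem _ _)) (sum_mem fun y _ => ?_)
  set t : G → ℂ := fun z => LinearMap.trace ℂ V (Algebra.lsmul ℂ ℂ V (gδ ℂ z⁻¹ y)) with ht
  change ∑ z : G, (Nat.card (commonRoots n y z) : ℂ) * t z ∈ _
  set E := Nat.card G with hE
  have hE0 : E ≠ 0 := Nat.card_pos.ne'
  set J := (Finset.range E).filter fun j => E.Coprime j with hJ
  have hshift : ∀ j ∈ J, ∑ z : G, (Nat.card (commonRoots n y z) : ℂ) * t z =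
      ∑ z : G, (Nat.card (commonRoots n y z) : ℂ) * t (z ^ j) := by
    intro j hj
    have hj' : E.Coprime j := (Finset.mem_filter.1 hj).2
    rw [← (powCoprime hj').sum_comp]
    refine Finset.sum_congr rfl fun z _ => ?_
    rw [powCoprime_apply, hcard y z j hj']
  have hJcard : (J.card : ℂ) ≠ 0 := by
    rw [hJ, ← Nat.totient_eq_card_coprime]
    exact_mod_cast (Nat.totient_pos.2 (Nat.pos_of_ne_zero hE0)).ne'
  have havg : ∑ z : G, (Nat.card (commonRoots n y z) : ℂ) * t z = (J.card : ℂ)⁻¹ *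
      ∑ z : G, (Nat.card (commonRoots n y z) : ℂ) * ∑ j ∈ J, t (z ^ j) := by
    rw [eq_inv_mul_iff_mul_eq₀ hJcard]
    simp only [Finset.mul_sum]
    rw [Finset.sum_comm, ← Finset.mul_sum, ← nsmul_eq_mul, ← Finset.sum_const]
    exact Finset.sum_congr rfl hshift
  rw [havg]
  refine mul_mem (inv_mem (natCast_mem _ _)) (sum_mem fun z _ => ?_)
  rcases isEmpty_or_nonempty (commonRoots n y z) with hempty | ⟨⟨a, ha, hay⟩⟩
  · rw [Nat.card_of_isEmpty, Nat.cast_zero, zero_mul]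
    exact zero_mem _
  refine mul_mem (natCast_mem _ _) ?_
  -- Commutation with `y` makes the elements `z^{-j} δ_y` multiply like powers of `z⁻¹`. It follows
  -- from the existence of a common root; without one the coefficient is zero.
  have hzy : Commute z y := by
    have h₁ : Commute z a := by rw [← ha]; exact Commute.pow_self a n
    have h₂ : Commute z (a * y) := by rw [← hay]; exact Commute.pow_self (a * y) n
    have := h₁.inv_right.mul_right h₂
    rwa [inv_mul_cancel_left] at this
  refine sum_coprime_trace_mem_rat (p := fun j => Algebra.lsmul ℂ ℂ V (gδ ℂ (z ^ j)⁻¹ y)) hE0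
    ?_ ?_
  · intro i j
    rw [← map_mul, gδ_mul_gδ, if_pos, pow_add, ← mul_inv_rev, ← pow_add, ← pow_add, add_comm]
    rw [inv_inv, (hzy.pow_left j).eq, mul_inv_cancel_right]
  · intro i
    simp only [pow_add, hE, pow_card_eq_one', mul_one]

end QuantumDouble

/-! ### Conclusion -/

theorem exists_int_of_isIntegral_of_mem_rat {x : ℂ} (hx : IsIntegral ℤ x)
    (hq : x ∈ (algebraMap ℚ ℂ).fieldRange) : ∃ m : ℤ, x = m := by
  obtain ⟨q, rfl⟩ := hq
  have hq' : IsIntegral ℤ q :=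
    (isIntegral_algebraMap_iff (algebraMap ℚ ℂ).injective).1 hx
  obtain ⟨m, hm⟩ := IsIntegrallyClosed.isIntegral_iff.1 hq'
  exact ⟨m, by rw [← hm]; simp⟩

instance {G : Type*} [Finite G] : Module.Finite ℂ (QuantumDouble ℂ G) :=
  inferInstanceAs (Module.Finite ℂ (G × G →₀ ℂ))

theorem finiteDimensional_of_isSimpleModule {k H V : Type*} [Field k] [Ring H] [Algebra k H]
    [Module.Finite k H] [AddCommGroup V] [Module k V] [Module H V] [IsScalarTower k H V]
    [IsSimpleModule H V] : FiniteDimensional k V :=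
  Module.Finite.trans H V

theorem theorem1 (A : Type*) [CommGroup A] [Finite A] (N : ℕ)
    (Λ : QuantumDouble ℂ (WreathProduct A N)) (hΛ : IsLeftIntegral ℂ Λ)
    (hΛ₁ : Coalgebra.counit (R := ℂ) Λ = 1)
    (V : Type*) [AddCommGroup V] [Module ℂ V] [Module (QuantumDouble ℂ (WreathProduct A N)) V]
    [IsScalarTower ℂ (QuantumDouble ℂ (WreathProduct A N)) V]
    [IsSimpleModule (QuantumDouble ℂ (WreathProduct A N)) V] (n : ℕ) :
    ∃ m : ℤ, frobeniusSchurIndicator ℂ Λ V n = (m : ℂ) := by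
  have : FiniteDimensional ℂ V :=
    finiteDimensional_of_isSimpleModule (H := QuantumDouble ℂ (WreathProduct A N))
  exact exists_int_of_isIntegral_of_mem_rat
    (QuantumDouble.isIntegral_frobeniusSchurIndicator hΛ hΛ₁ V n)
    (QuantumDouble.frobeniusSchurIndicator_mem_rat hΛ hΛ₁ n
      fun y z _ hj => WreathProduct.card_commonRoots_pow n y z hj)
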